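/- Setting. Let $P_X$ be a probability law on $\mathbb C$ with $\mathbb E|x|^2=1$, let $snr>0$, and let logarithms be natural. Let $\mathbf x$ have $N$ i.i.d. entries of law $P_X$, let $\mathbf z\sim\mathcal{CN}(0,I_N)$ be independent of $\mathbf x$, and put $$\hat\phi^{\mathcal S}_{\rm SE}(\rho)=\tfrac1N\,\mathbb E\big\|\mathbf x-\mathbb E[\mathbf x\mid\sqrt\rho\,\mathbf x+\mathbf z]\big\|^2 .$$ For an $M\times N$ complex matrix $A$ (with $N\ge1$) put $\hat\gamma_{\rm SE}(v)=\frac1N{\rm tr}\{(snr\,A^HA+v^{-1}I)^{-1}\}$ for $v>0$, let $\hat\gamma^{-1}_{\rm SE}$ be its inverse, and put $\eta_{\rm SE}(v)=v^{-1}-[\hat\gamma_{\rm SE}^{-1}(v)]^{-1}$ for $v$ in the range of $\hat\gamma_{\rm SE}$. Write $v=\eta_{\rm SE}^{-1}(\rho)$ if $v$ lies in that range and $\eta_{\rm SE}(v)=\rho$. For a spectral law $\mu$ on $[0,\infty)$ with Stieltjes transform $S(z)=\int (x-z)^{-1}d\mu(x)$, $z<0$, let $\mathcal R(s)=S^{-1}(-s)-1/s$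 ($s<0$) be its R-transform. The replica-predicted constrained capacity is $$C^{\rm Rep}_{\rm LUIS}=\int_0^{v\,snr}\mathcal R(-z)\,dz+I(x;\sqrt{\rho}\,x+z)-\rho v ,$$ where $x\sim P_X$ and $z\sim\mathcal{CN}(0,1)$ are independent scalars and $(\rho,v)$ is the unique solution of $\rho=snr\,\mathcal R(-snr\,v)$, $v=\hat\phi^{\mathcal S}_{\rm SE}(\rho)$. Theorem. Assume that $\hat\phi^{\mathcal S}_{\rm SE}(\rho)=\eta_{\rm SE}^{-1}(\rho)$ has exactly one solution $\rho^*$ in $\rho>0$, and let $v^*=\hat\phi^{\mathcal S}_{\rm SE}(\rho^*)$. (i) For every such matrix $A$, with $\mathcal R$ the R-transform of the empirical eigenvalue distribution of $A^HA$: one has $v^*>0$ and $[v^*]^{-1}-\rho^*>0$, the replica equations have a unique solution, all quantities in the definition of $C^{\rm Rep}_{\rm LUIS}$ are finite, and $$C^{\rm Rep}_{\rm LUIS}=\int_0^{\rho^*}\hat\phi^{\mathcal S}_{\rm SE}(\rho)\,d\rho+\log v^*+\tfrac1N\log\det\big(([v^*]^{-1}-\rho^*)I+snr\,A^HA\big).$$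 Moreover this number is the area of the region in the quadrant $\rho>0$, $v>0$ that lies below both curves $v=\hat\phi^{\mathcal S}_{\rm SE}(\rho)$ and $v=\eta_{\rm SE}^{-1}(\rho)$ (where the second curve is taken at height $\infty$ for $\rho$ to the left of the range of $\eta_{\rm SE}$, and $0$ to the right of it). (ii) The same holds in the large-system limit. Let $A_k$ be random $M_k\times N_k$ matrices with right-unitarily invariant laws, $M_k,N_k\to\infty$, $N_k/M_k\to\beta>0$, such that almost surely the empirical eigenvalue distributions of $A_k^HA_k$ converge weakly, together with their means, to a law $\mu$ with finite mean and its mean. Let $\hat\gamma_{\rm SE}$ and $\hat\phi^{\mathcal S}_{\rm SE}$ denote the (almost sure, respectively deterministic) limits of the corresponding functions of $A_k$ and $N_k$, and let $\mathcal R$ be the R-transform of $\mu$. Then the conclusions of (i) hold with $\frac1N\log\det(\cdot)$ replaced by the almost sure limit of $\frac1{N_k}\log\det\big(([v^*]^{-1}-\rho^*)I+snr\,A_k^HA_k\big)$, which exists. -/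

import Mathlib

open MeasureTheory ProbabilityTheory Filter Topology Set Matrix
open scoped ENNReal NNReal

noncomputable section

namespace LUIS

/-! ### The scalar and vector Gaussian observation channel -/

/-- The circularly symmetric complex Gaussian law `CN(0,1)`: real and imaginary part are
independent real Gaussians with mean `0` and variance `1/2`. -/
def stdCN : Measure ℂ :=
  ((gaussianReal 0 (1 / 2)).prod (gaussianReal 0 (1 / 2))).map
    (fun p : ℝ × ℝ => (⟨p.1, p.2⟩ : ℂ))

/-- The joint law of `(x, z)`: the entries of `x` are i.i.d. with law `P`, the entries of `z` are
i.i.d. `CN(0,1)`, and `x`, `z` are independent. -/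
def signalNoise (P : Measure ℂ) (n : ℕ) : Measure ((Fin n → ℂ) × (Fin n → ℂ)) :=
  (Measure.pi fun _ => P).prod (Measure.pi fun _ => stdCN)

/-- The observation `y = √ρ x + z`. -/
def observation (n : ℕ) (ρ : ℝ) (p : (Fin n → ℂ) × (Fin n → ℂ)) : Fin n → ℂ :=
  fun i => (Real.sqrt ρ : ℂ) * p.1 i + p.2 i

/-- The per-symbol MMSE `(1/n) E ‖x - E[x | √ρ x + z]‖²` of `n` i.i.d. symbols with law `P`. -/
def phiHat (P : Measure ℂ) (n : ℕ) (ρ : ℝ) : ℝ :=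
  (n : ℝ)⁻¹ * ∑ i : Fin n, ∫ p, ‖p.1 i -
    ((signalNoise P n)[(fun q : (Fin n → ℂ) × (Fin n → ℂ) => q.1 i) |
      MeasurableSpace.comap (observation n ρ) inferInstance]) p‖ ^ 2 ∂(signalNoise P n)

/-- The mutual information (in nats) of two complex random variables on a measure space: the
Kullback-Leibler divergence of the joint law from the product of the marginal laws. -/
def mutualInfo {Ω : Type*} [MeasurableSpace Ω] (μ : Measure Ω) (X Y : Ω → ℂ) : ℝ≥0∞ :=
  InformationTheory.klDiv (μ.map fun ω => (X ω, Y ω)) ((μ.map X).prod (μ.map Y))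

/-- `I(x; √ρ x + z)` for a scalar `x` with law `P` and independent `z` with law `CN(0,1)`. -/
def channelInfo (P : Measure ℂ) (ρ : ℝ) : ℝ≥0∞ :=
  mutualInfo (P.prod stdCN) (fun p => p.1) (fun p => (Real.sqrt ρ : ℂ) * p.1 + p.2)

/-! ### Spectral laws, the R-transform and the linear estimator -/

/-- The empirical eigenvalue distribution of the Gram matrix `Aᴴ A`. -/
def gramLaw {M N : ℕ} (A : Matrix (Fin M) (Fin N) ℂ) : Measure ℝ :=
  (N : ℝ≥0∞)⁻¹ •
    ∑ i : Fin N, Measure.dirac ((isHermitian_conjTranspose_mul_self A).eigenvalues i)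

/-- The Stieltjes transform `z ↦ E[1 / (X - z)]` of a spectral law. -/
def stieltjes (μ : Measure ℝ) (z : ℝ) : ℝ := ∫ x, (x - z)⁻¹ ∂μ

/-- The R-transform `R(s) = S⁻¹(-s) - 1/s` at negative arguments `s`, for a law on `[0, ∞)`; `S⁻¹`
is the inverse of the Stieltjes transform on the half-line `(-∞, 0)`. -/
def rTransform (μ : Measure ℝ) (s : ℝ) : ℝ :=
  Function.invFunOn (stieltjes μ) (Iio 0) (-s) - 1 / s

/-- `γ̂(v) = (1/N) tr [(snr Aᴴ A + v⁻¹ I)⁻¹]`; the trace is real. -/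
def gammaHat (snr : ℝ) {M N : ℕ} (A : Matrix (Fin M) (Fin N) ℂ) (v : ℝ) : ℝ :=
  (N : ℝ)⁻¹ * (trace ((snr : ℂ) • (Aᴴ * A) + ((v⁻¹ : ℝ) : ℂ) • (1 : Matrix (Fin N) (Fin N) ℂ))⁻¹).re

/-- `(1/N) log det (c I + snr Aᴴ A)`; the determinant is real, and positive when `c, snr > 0`. -/
def logDet (snr : ℝ) {M N : ℕ} (A : Matrix (Fin M) (Fin N) ℂ) (c : ℝ) : ℝ :=
  (N : ℝ)⁻¹ * Real.log (det ((c : ℂ) • (1 : Matrix (Fin N) (Fin N) ℂ) + (snr : ℂ) • (Aᴴ * A))).re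

/-! ### Transfer functions, fixed points and the enclosed area

Here `γ` stands for the transfer function `γ̂` on `(0, ∞)` and `φ` for the transfer function `φ̂`. -/

/-- The domain of `η`: the values at which the inverse of `γ` is defined. -/
def etaDomain (γ : ℝ → ℝ) : Set ℝ := γ '' Ioi 0

/-- `η(v) = v⁻¹ - [γ⁻¹(v)]⁻¹`. -/
def eta (γ : ℝ → ℝ) (v : ℝ) : ℝ := v⁻¹ - (Function.invFunOn γ (Ioi 0) v)⁻¹

/-- `v = η⁻¹(ρ)`, as an inverse relation (it also covers the degenerate case of a constant `η`). -/
def IsEtaInv (γ : ℝ → ℝ) (ρ v : ℝ) : Prop := v ∈ etaDomain γ ∧ eta γ v = ρ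

/-- `ρ > 0` solves the fixed-point equation `φ(ρ) = η⁻¹(ρ)`. -/
def IsFixedPoint (γ φ : ℝ → ℝ) (ρ : ℝ) : Prop := 0 < ρ ∧ IsEtaInv γ ρ (φ ρ)

/-- `ρ` is the only solution of `φ(ρ) = η⁻¹(ρ)` in `ρ > 0`. -/
def IsUniqueFixedPoint (γ φ : ℝ → ℝ) (ρ : ℝ) : Prop :=
  IsFixedPoint γ φ ρ ∧ ∀ ρ', IsFixedPoint γ φ ρ' → ρ' = ρ

/-- The points `(ρ, v)` of the open first quadrant below both curves `v = φ(ρ)` and `v = η⁻¹(ρ)`.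
As `η` is decreasing, `(ρ, v)` is below the second curve iff `v ≤ u` for all `u` with `η(u) ≤ ρ`:
the curve is at height `∞` left of the range of `η` and at height `0` right of it. -/
def areaRegion (γ φ : ℝ → ℝ) : Set (ℝ × ℝ) :=
  {p | 0 < p.1 ∧ 0 < p.2 ∧ p.2 ≤ φ p.1 ∧ ∀ u ∈ etaDomain γ, eta γ u ≤ p.1 → p.2 ≤ u}

/-- `C` is the area enclosed by the two curves and the coordinate axes. -/
def IsEnclosedArea (γ φ : ℝ → ℝ) (C : ℝ) : Prop :=
  volume (areaRegion γ φ) ≠ ∞ ∧ C = (volume (areaRegion γ φ)).toReal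

/-! ### The replica prediction -/

/-- `(ρ, v)` solves the replica equations `ρ = snr R(-snr v)`, `v = φ(ρ)`, where `snr v` lies in the
range on which the inverse Stieltjes transform, and so the R-transform, is defined. -/
def IsReplicaPoint (snr : ℝ) (μ : Measure ℝ) (φ : ℝ → ℝ) (ρ v : ℝ) : Prop :=
  0 ≤ ρ ∧ snr * v ∈ stieltjes μ '' Iio 0 ∧ ρ = snr * rTransform μ (-(snr * v)) ∧ v = φ ρ

/-- `C` is the constrained capacity predicted by the replica method for spectral law `μ`, signal law
`P` and MMSE function `φ`: the replica equations have a unique solution `(ρ, v)`, and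
`C = ∫₀^{v snr} R(-z) dz + I(x; √ρ x + z) - ρ v`, all terms being well defined and finite. -/
def IsReplicaCapacity (snr : ℝ) (μ : Measure ℝ) (P : Measure ℂ) (φ : ℝ → ℝ) (C : ℝ) : Prop :=
  ∃ ρ v : ℝ, IsReplicaPoint snr μ φ ρ v ∧
    (∀ ρ' v', IsReplicaPoint snr μ φ ρ' v' → ρ' = ρ ∧ v' = v) ∧
    IntervalIntegrable (fun z => rTransform μ (-z)) volume 0 (v * snr) ∧
    channelInfo P ρ ≠ ∞ ∧
    C = (∫ z in (0 : ℝ)..(v * snr), rTransform μ (-z)) + (channelInfo P ρ).toReal - ρ * v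

/-! ### Large unitarily invariant systems -/

/-- A sequence of random matrices `A k` of size `M k × N k` is a large unitarily invariant system
with limiting spectral law `μ` of `Aᴴ A`. The last two fields say that the empirical eigenvalue
distribution converges almost surely, weakly and in mean. -/
structure IsLUIS {Ω : Type*} [MeasurableSpace Ω] (Q : Measure Ω) (M N : ℕ → ℕ)
    (A : (k : ℕ) → Ω → Matrix (Fin (M k)) (Fin (N k)) ℂ) (μ : Measure ℝ) : Prop where
  rows : Tendsto M atTop atTop
  cols : Tendsto N atTop atTop
  ratio : ∃ β : ℝ, 0 < β ∧ Tendsto (fun k => (N k : ℝ) / (M k : ℝ)) atTop (𝓝 β)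
  measurable : ∀ k i j, Measurable fun ω => A k ω i j
  right_invariant : ∀ k, ∀ V ∈ unitaryGroup (Fin (N k)) ℂ,
    Q.map (fun ω i j => (A k ω * V) i j) = Q.map (fun ω i j => A k ω i j)
  prob : IsProbabilityMeasure μ
  integrable : Integrable (fun x => x) μ
  tendsto_law : ∀ᵐ ω ∂Q, ∀ f : BoundedContinuousFunction ℝ ℝ,
    Tendsto (fun k => ∫ x, f x ∂(gramLaw (A k ω))) atTop (𝓝 (∫ x, f x ∂μ))
  tendsto_mean : ∀ᵐ ω ∂Q,
    Tendsto (fun k => ∫ x, x ∂(gramLaw (A k ω))) atTop (𝓝 (∫ x, x ∂μ))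

end LUIS

end

noncomputable section

namespace LUIS

/-! ### Resolvent and logarithmic potential of a spectral law -/

/-! Everything on the linear side is a function of the resolvent G(t) = ∫ (a x + t)⁻¹ dμ with a =
snr. Since γ̂(w) = G(1/w), the point v = G(t) satisfies η(v) = 1/G(t) - t, and likewise a R(-a v) =
1/G(t) - t. So η and the rescaled R-transform are one function, with graph parametrized by t ↦
(`etaParam μ a t`, G(t)). Along it G decreases strictly to 0 and 1/G - t is nondecreasing, because
G² ≤ -G'. The function log G + ∫ log(a x + t) dμ - t G has derivative G' (1/G - t) and limit -1 at
infinity, so substituting v = G(t) integrates η in closed form (`integral_eta`).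

On the signal side the vector channel decouples into scalar channels (`condExp_observation`), so φ̂
is the scalar MMSE, and its integral is the mutual information (`integral_mmse`). The I-MMSE
relation comes from convexity: a Gibbs inequality bounds every increment of the information from
above (`gaussianInfo_sub_le`), exchanging the two amplitudes bounds it from below, and continuity of
the MMSE closes the gap.

Uniqueness of the fixed point means that φ - G changes sign exactly once along the curve
(`exists_crossing`). The region therefore splits at ρ*: it is bounded by φ on the left and by η on
the right, with area ∫₀^{ρ*} φ + ∫₀^{v*} (η - ρ*). This is already the replica expression, and t* v*
+ ρ* v* = 1, where t* = 1/v* - ρ*, reduces it to the log-determinant formula. `capacity_eq_area`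
states this for any spectral law on [0, ∞) with finite mean, hence for a Gram matrix and for a limit
law alike. In the limit, weak convergence identifies γ̂, and convergence of the means adds the
logarithmic potential. -/

/-- A spectral law: a probability law on `[0, ∞)` with finite mean. -/
structure IsSpectralLaw (μ : Measure ℝ) : Prop where
  prob : IsProbabilityMeasure μ
  nonneg : ∀ᵐ x ∂μ, 0 ≤ x
  integrable : Integrable (fun x => x) μ

/-- `∫ (a x + t)⁻¹ dμ`. -/
def resolventMean (μ : Measure ℝ) (a t : ℝ) : ℝ := ∫ x, (a * x + t)⁻¹ ∂μ

/-- `∫ log (a x + t) dμ`. -/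
def logPotential (μ : Measure ℝ) (a t : ℝ) : ℝ := ∫ x, Real.log (a * x + t) ∂μ

/-- The transfer function `η` at the point `v = resolventMean μ a t`. -/
def etaParam (μ : Measure ℝ) (a t : ℝ) : ℝ := (resolventMean μ a t)⁻¹ - t

namespace IsSpectralLaw

variable {μ : Measure ℝ} {a : ℝ}

lemma integrable_inv_pow (h : IsSpectralLaw μ) (ha : 0 < a) {t : ℝ} (ht : 0 < t) (n : ℕ) :
    Integrable (fun x => ((a * x + t)⁻¹) ^ n) μ := by
  have := h.prob
  refine Integrable.of_bound (C := (t⁻¹) ^ n) (by fun_prop) ?_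
  filter_upwards [h.nonneg] with x hx
  have h1 : 0 < a * x + t := by positivity
  rw [norm_pow, Real.norm_of_nonneg (by positivity)]
  gcongr
  nlinarith

lemma integrable_inv (h : IsSpectralLaw μ) (ha : 0 < a) {t : ℝ} (ht : 0 < t) :
    Integrable (fun x => (a * x + t)⁻¹) μ := by
  simpa using h.integrable_inv_pow ha ht 1

lemma integrable_log (h : IsSpectralLaw μ) (ha : 0 < a) {t : ℝ} (ht : 0 < t) :
    Integrable (fun x => Real.log (a * x + t)) μ := by
  have := h.prob
  refine Integrable.mono' (g := fun x => |Real.log t| + a * x / t)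
    ((integrable_const _).add ((h.integrable.const_mul a).div_const t))
    (Measurable.aestronglyMeasurable (by fun_prop)) ?_
  filter_upwards [h.nonneg] with x hx
  -- With the factor t split off, log(1 + y) ≤ y bounds the logarithm linearly in x, and the mean is
  -- finite.
  have h1 : a * x + t = t * (1 + a * x / t) := by field_simp; ring
  have h2 : 0 ≤ a * x / t := by positivity
  rw [h1, Real.log_mul ht.ne' (by positivity)]
  refine (norm_add_le _ _).trans ?_
  rw [Real.norm_eq_abs, Real.norm_of_nonneg (Real.log_nonneg (by linarith))]
  linarith [Real.log_le_sub_one_of_pos (show 0 < 1 + a * x / t by positivity)]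

lemma inv_le_resolventMean (h : IsSpectralLaw μ) (ha : 0 < a) {t : ℝ} (ht : 0 < t) :
    (a * (∫ x, x ∂μ) + t)⁻¹ ≤ resolventMean μ a t := by
  have := h.prob
  have hc : 0 < a * (∫ x, x ∂μ) + t := by
    have : 0 ≤ ∫ x, x ∂μ := integral_nonneg_of_ae h.nonneg
    positivity
  set c := a * (∫ x, x ∂μ) + t with hcdef
  have hI : Integrable (fun x => a * x + t) μ :=
    (h.integrable.const_mul a).add (integrable_const _)
  have h1 : ∫ x, (2 / c - (a * x + t) / c ^ 2) ∂μ = c⁻¹ := by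
    rw [integral_sub (integrable_const _) (hI.div_const _), integral_div (c ^ 2) (fun x => a * x + t),
      integral_add (h.integrable.const_mul a) (integrable_const _), integral_const_mul]
    simp only [integral_const, probReal_univ, one_smul]
    rw [← hcdef]
    field_simp
    norm_num
  rw [← h1]
  refine integral_mono_ae ((integrable_const _).sub (hI.div_const _))
    (h.integrable_inv ha ht) ?_
  filter_upwards [h.nonneg] with x hx
  have h2 : 0 < a * x + t := by positivity
  have : (a * x + t)⁻¹ - (2 / c - (a * x + t) / c ^ 2)
      = (a * x + t - c) ^ 2 / (c ^ 2 * (a * x + t)) := by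
    field_simp
    ring
  have h3 : 0 ≤ (a * x + t - c) ^ 2 / (c ^ 2 * (a * x + t)) := by positivity
  linarith

lemma resolventMean_pos (h : IsSpectralLaw μ) (ha : 0 < a) {t : ℝ} (ht : 0 < t) :
    0 < resolventMean μ a t := by
  have : 0 ≤ ∫ x, x ∂μ := integral_nonneg_of_ae h.nonneg
  exact lt_of_lt_of_le (inv_pos.2 (by positivity)) (h.inv_le_resolventMean ha ht)

lemma resolventMean_le_inv (h : IsSpectralLaw μ) (ha : 0 < a) {t : ℝ} (ht : 0 < t) :
    resolventMean μ a t ≤ t⁻¹ := by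
  have := h.prob
  have h1 : ∫ _, t⁻¹ ∂μ = t⁻¹ := by simp
  rw [← h1]
  refine integral_mono_ae (h.integrable_inv ha ht) (integrable_const _) ?_
  filter_upwards [h.nonneg] with x hx
  have : 0 ≤ a * x := by positivity
  exact inv_anti₀ ht (by linarith)

lemma etaParam_nonneg (h : IsSpectralLaw μ) (ha : 0 < a) {t : ℝ} (ht : 0 < t) :
    0 ≤ etaParam μ a t := by
  have h1 := h.resolventMean_le_inv ha ht
  have h2 := inv_anti₀ (h.resolventMean_pos ha ht) h1
  rw [inv_inv] at h2
  exact sub_nonneg.2 h2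

/-- This uniform bound keeps the MMSE along the curve away from 0 in `exists_crossing`. -/
lemma etaParam_le (h : IsSpectralLaw μ) (ha : 0 < a) {t : ℝ} (ht : 0 < t) :
    etaParam μ a t ≤ a * ∫ x, x ∂μ := by
  have hc : 0 < a * (∫ x, x ∂μ) + t := by
    have : 0 ≤ ∫ x, x ∂μ := integral_nonneg_of_ae h.nonneg
    positivity
  have h2 := inv_anti₀ (inv_pos.2 hc) (h.inv_le_resolventMean ha ht)
  rw [inv_inv] at h2
  unfold etaParam
  linarith

lemma hasDerivAt_resolventMean (h : IsSpectralLaw μ) (ha : 0 < a) {t : ℝ} (ht : 0 < t) :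
    HasDerivAt (resolventMean μ a) (-∫ x, ((a * x + t)⁻¹) ^ 2 ∂μ) t := by
  have := h.prob
  rw [← integral_neg]
  -- On (t/2, ∞) the denominator stays at least t/2, so a constant dominates the derivative.
  refine (hasDerivAt_integral_of_dominated_loc_of_deriv_le (s := Ioi (t / 2))
    (F := fun t x => (a * x + t)⁻¹) (F' := fun t x => -((a * x + t)⁻¹) ^ 2)
    (bound := fun _ => ((t / 2)⁻¹) ^ 2)
    (Ioi_mem_nhds (by linarith)) (Eventually.of_forall fun s => by fun_prop)
    (h.integrable_inv ha ht) (by fun_prop) ?_ (integrable_const _) ?_).2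
  · filter_upwards [h.nonneg] with x hx s hs
    have hs' : t / 2 < s := hs
    have h1 : 0 ≤ a * x := by positivity
    rw [norm_neg, norm_pow, Real.norm_of_nonneg (inv_nonneg.2 (by linarith))]
    have : (a * x + s)⁻¹ ≤ (t / 2)⁻¹ := inv_anti₀ (by positivity) (by linarith)
    have h3 : 0 ≤ (a * x + s)⁻¹ := inv_nonneg.2 (by linarith)
    gcongr
  · filter_upwards [h.nonneg] with x hx s hs
    have hs' : t / 2 < s := hs
    have h1 : 0 ≤ a * x := by positivity
    have h2 : a * x + s ≠ 0 := by linarith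
    have := ((hasDerivAt_id s).const_add (a * x)).fun_inv h2
    simpa [neg_div] using this

lemma hasDerivAt_logPotential (h : IsSpectralLaw μ) (ha : 0 < a) {t : ℝ} (ht : 0 < t) :
    HasDerivAt (logPotential μ a) (resolventMean μ a t) t := by
  have := h.prob
  refine (hasDerivAt_integral_of_dominated_loc_of_deriv_le (s := Ioi (t / 2))
    (F := fun t x => Real.log (a * x + t)) (F' := fun t x => (a * x + t)⁻¹)
    (bound := fun _ => (t / 2)⁻¹)
    (Ioi_mem_nhds (by linarith))
    (Eventually.of_forall fun s => Measurable.aestronglyMeasurable (by fun_prop))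
    (h.integrable_log ha ht) (by fun_prop) ?_ (integrable_const _) ?_).2
  · filter_upwards [h.nonneg] with x hx s hs
    have hs' : t / 2 < s := hs
    have h1 : 0 ≤ a * x := by positivity
    rw [Real.norm_of_nonneg (inv_nonneg.2 (by linarith))]
    exact inv_anti₀ (by positivity) (by linarith)
  · filter_upwards [h.nonneg] with x hx s hs
    have hs' : t / 2 < s := hs
    have h1 : 0 ≤ a * x := by positivity
    have h2 : a * x + s ≠ 0 := by linarith
    simpa using ((hasDerivAt_id s).const_add (a * x)).log h2

/-- The variance of (a x + t)⁻¹ under μ is nonnegative. This is the source of the monotonicity of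
`etaParam`. -/
lemma sq_resolventMean_le (h : IsSpectralLaw μ) (ha : 0 < a) {t : ℝ} (ht : 0 < t) :
    resolventMean μ a t ^ 2 ≤ ∫ x, ((a * x + t)⁻¹) ^ 2 ∂μ := by
  have := h.prob
  set c := resolventMean μ a t with hc
  have h0 : 0 ≤ ∫ x, ((a * x + t)⁻¹ - c) ^ 2 ∂μ := integral_nonneg fun x => sq_nonneg _
  have h1 : ∫ x, ((a * x + t)⁻¹ - c) ^ 2 ∂μ
      = ∫ x, (((a * x + t)⁻¹) ^ 2 - 2 * c * (a * x + t)⁻¹ + c ^ 2) ∂μ := by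
    congr 1; ext x; ring
  have hI : Integrable (fun x => ((a * x + t)⁻¹) ^ 2 - 2 * c * (a * x + t)⁻¹) μ :=
    (h.integrable_inv_pow ha ht 2).sub ((h.integrable_inv ha ht).const_mul _)
  rw [h1, integral_add hI (integrable_const _), integral_sub (h.integrable_inv_pow ha ht 2)
    ((h.integrable_inv ha ht).const_mul _), integral_const_mul] at h0
  have h2 : ∫ x, (a * x + t)⁻¹ ∂μ = c := rfl
  simp only [integral_const, probReal_univ, one_smul, h2] at h0
  nlinarith

lemma deriv_resolventMean_neg (h : IsSpectralLaw μ) (ha : 0 < a) {t : ℝ} (ht : 0 < t) :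
    -∫ x, ((a * x + t)⁻¹) ^ 2 ∂μ < 0 := by
  have h1 := h.sq_resolventMean_le ha ht
  have h2 := h.resolventMean_pos ha ht
  nlinarith [sq_pos_of_pos h2]

lemma continuousOn_resolventMean (h : IsSpectralLaw μ) (ha : 0 < a) :
    ContinuousOn (resolventMean μ a) (Ioi 0) := fun _ ht =>
  (h.hasDerivAt_resolventMean ha ht).continuousAt.continuousWithinAt

lemma strictAntiOn_resolventMean (h : IsSpectralLaw μ) (ha : 0 < a) :
    StrictAntiOn (resolventMean μ a) (Ioi 0) := by
  refine strictAntiOn_of_deriv_neg (convex_Ioi 0) (h.continuousOn_resolventMean ha) ?_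
  intro t ht
  rw [interior_Ioi] at ht
  rw [(h.hasDerivAt_resolventMean ha ht).deriv]
  exact h.deriv_resolventMean_neg ha ht

lemma hasDerivAt_etaParam (h : IsSpectralLaw μ) (ha : 0 < a) {t : ℝ} (ht : 0 < t) :
    HasDerivAt (etaParam μ a)
      ((∫ x, ((a * x + t)⁻¹) ^ 2 ∂μ) / resolventMean μ a t ^ 2 - 1) t := by
  have := ((h.hasDerivAt_resolventMean ha ht).fun_inv (h.resolventMean_pos ha ht).ne').fun_sub
    (hasDerivAt_id t)
  rw [neg_neg] at this
  exact this

lemma continuousOn_etaParam (h : IsSpectralLaw μ) (ha : 0 < a) :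
    ContinuousOn (etaParam μ a) (Ioi 0) := fun _ ht =>
  (h.hasDerivAt_etaParam ha ht).continuousAt.continuousWithinAt

lemma monotoneOn_etaParam (h : IsSpectralLaw μ) (ha : 0 < a) :
    MonotoneOn (etaParam μ a) (Ioi 0) := by
  refine monotoneOn_of_deriv_nonneg (convex_Ioi 0) (h.continuousOn_etaParam ha) ?_ ?_
  · intro t ht
    rw [interior_Ioi] at ht
    exact (h.hasDerivAt_etaParam ha ht).differentiableAt.differentiableWithinAt
  · intro t ht
    rw [interior_Ioi] at ht
    rw [(h.hasDerivAt_etaParam ha ht).deriv, sub_nonneg,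
      one_le_div (pow_pos (h.resolventMean_pos ha ht) 2)]
    exact h.sq_resolventMean_le ha ht

lemma tendsto_resolventMean (h : IsSpectralLaw μ) (ha : 0 < a) :
    Tendsto (resolventMean μ a) atTop (𝓝 0) := by
  refine squeeze_zero' ?_ ?_ tendsto_inv_atTop_zero
  · filter_upwards [eventually_gt_atTop 0] with t ht using (h.resolventMean_pos ha ht).le
  · filter_upwards [eventually_gt_atTop 0] with t ht using h.resolventMean_le_inv ha ht

/-- If `η` vanishes somewhere, it vanishes identically. -/
lemma etaParam_eq_zero (h : IsSpectralLaw μ) (ha : 0 < a) {t : ℝ} (ht : 0 < t)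
    (h0 : etaParam μ a t = 0) {t' : ℝ} : etaParam μ a t' = 0 := by
  have := h.prob
  have h1 : resolventMean μ a t = t⁻¹ := by
    rw [← inv_inv (resolventMean μ a t), sub_eq_zero.1 h0]
  have h2 : ∫ x, (t⁻¹ - (a * x + t)⁻¹) ∂μ = 0 := by
    rw [integral_sub (integrable_const _) (h.integrable_inv ha ht)]
    change _ - resolventMean μ a t = 0
    simp [h1]
  -- Equality in the pointwise bound (a x + t)⁻¹ ≤ t⁻¹ forces μ to be concentrated at 0.
  have h3 : ∀ᵐ x ∂μ, x = 0 := by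
    rw [integral_eq_zero_iff_of_nonneg_ae] at h2
    · filter_upwards [h2, h.nonneg] with x hx hx0
      have hx' : t⁻¹ = (a * x + t)⁻¹ := sub_eq_zero.1 hx
      have : t = a * x + t := inv_injective hx'
      have : a * x = 0 := by linarith
      exact (mul_eq_zero.1 this).resolve_left ha.ne'
    · filter_upwards [h.nonneg] with x hx
      have : 0 ≤ a * x := by positivity
      exact sub_nonneg.2 (inv_anti₀ ht (by linarith))
    · exact (integrable_const _).sub (h.integrable_inv ha ht)
  have h4 : resolventMean μ a t' = t'⁻¹ := by
    have : ∫ x, (a * x + t')⁻¹ ∂μ = ∫ _, t'⁻¹ ∂μ := by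
      refine integral_congr_ae ?_
      filter_upwards [h3] with x hx
      simp [hx]
    simpa [resolventMean] using this
  simp [etaParam, h4]

/-- The resolvent values above `t` fill an interval. -/
lemma image_Ioi_resolventMean (h : IsSpectralLaw μ) (ha : 0 < a) {t : ℝ} (ht : 0 < t) :
    resolventMean μ a '' Ioi t = Ioo 0 (resolventMean μ a t) := by
  ext v
  constructor
  · rintro ⟨u, hu, rfl⟩
    exact ⟨h.resolventMean_pos ha (ht.trans hu),
      h.strictAntiOn_resolventMean ha ht (mem_Ioi.2 (ht.trans hu)) hu⟩
  · rintro ⟨h0, h1⟩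
    obtain ⟨b, hb, hbt⟩ := (((h.tendsto_resolventMean ha).eventually (gt_mem_nhds h0)).and
      (eventually_gt_atTop t)).exists
    obtain ⟨u, hu, rfl⟩ := intermediate_value_Icc' hbt.le
      ((h.continuousOn_resolventMean ha).mono fun x hx => ht.trans_le hx.1) ⟨hb.le, h1.le⟩
    refine ⟨u, lt_of_le_of_ne hu.1 ?_, rfl⟩
    rintro rfl
    exact lt_irrefl _ h1

/-- An antiderivative of `G' (1 / G - t)`, where `G` is the resolvent. -/
lemma hasDerivAt_primitive (h : IsSpectralLaw μ) (ha : 0 < a) {t : ℝ} (ht : 0 < t) :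
    HasDerivAt (fun t => Real.log (resolventMean μ a t) + logPotential μ a t
      - t * resolventMean μ a t) ((-∫ x, ((a * x + t)⁻¹) ^ 2 ∂μ) * etaParam μ a t) t := by
  have h1 := h.hasDerivAt_resolventMean ha ht
  -- The derivative G of the potential cancels the -G produced by differentiating -t G.
  have := ((h1.log (h.resolventMean_pos ha ht).ne').add
    (h.hasDerivAt_logPotential ha ht)).sub ((hasDerivAt_id t).mul h1)
  refine this.congr_deriv ?_
  have := (h.resolventMean_pos ha ht).ne'
  simp only [etaParam, id]
  field_simp
  ring

/-- Rewritten as log(t G) + (∫ log(a x + t) dμ - log t) - t G, where t G → 1 and the bracket lies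
between 0 and a m / t, with m the mean of μ. -/
lemma tendsto_primitive (h : IsSpectralLaw μ) (ha : 0 < a) :
    Tendsto (fun t => Real.log (resolventMean μ a t) + logPotential μ a t
      - t * resolventMean μ a t) atTop (𝓝 (-1)) := by
  have := h.prob
  set m := ∫ x, x ∂μ with hm
  have hm0 : 0 ≤ m := integral_nonneg_of_ae h.nonneg
  have hq : Tendsto (fun t : ℝ => a * m / t) atTop (𝓝 0) :=
    tendsto_const_nhds.div_atTop tendsto_id
  have h1 : Tendsto (fun t => t * resolventMean μ a t) atTop (𝓝 1) := by
    have hl : Tendsto (fun t : ℝ => (a * m / t + 1)⁻¹) atTop (𝓝 1) := by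
      simpa using (hq.add_const 1).inv₀ (by norm_num)
    refine tendsto_of_tendsto_of_tendsto_of_le_of_le' hl tendsto_const_nhds ?_ ?_
    · filter_upwards [eventually_gt_atTop 0] with t ht
      have h2 := mul_le_mul_of_nonneg_left (h.inv_le_resolventMean ha ht) ht.le
      refine le_trans (le_of_eq ?_) h2
      have : 0 < a * m + t := by positivity
      rw [← hm]
      field_simp
    · filter_upwards [eventually_gt_atTop 0] with t ht
      have h2 := mul_le_mul_of_nonneg_left (h.resolventMean_le_inv ha ht) ht.le
      rwa [mul_inv_cancel₀ ht.ne'] at h2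
  have h2 : Tendsto (fun t => logPotential μ a t - Real.log t) atTop (𝓝 0) := by
    have key : ∀ t : ℝ, 0 < t → logPotential μ a t - Real.log t
        = ∫ x, (Real.log (a * x + t) - Real.log t) ∂μ := by
      intro t ht
      rw [integral_sub (h.integrable_log ha ht) (integrable_const _)]
      simp [logPotential]
    refine squeeze_zero' ?_ ?_ hq
    · filter_upwards [eventually_gt_atTop 0] with t ht
      rw [key t ht]
      refine integral_nonneg_of_ae ?_
      filter_upwards [h.nonneg] with x hx
      have : 0 ≤ a * x := by positivity
      exact sub_nonneg.2 (Real.log_le_log ht (by linarith))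
    · filter_upwards [eventually_gt_atTop 0] with t ht
      rw [key t ht, hm, ← integral_const_mul, ← integral_div]
      refine integral_mono_ae ((h.integrable_log ha ht).sub (integrable_const _))
        ((h.integrable.const_mul a).div_const t) ?_
      filter_upwards [h.nonneg] with x hx
      have : 0 ≤ a * x := by positivity
      have h3 : 0 < a * x + t := by positivity
      rw [← Real.log_div h3.ne' ht.ne']
      refine (Real.log_le_sub_one_of_pos (by positivity)).trans (le_of_eq ?_)
      field_simp
      ring
  have h3 : Tendsto (fun t => Real.log (t * resolventMean μ a t)
      + (logPotential μ a t - Real.log t) - t * resolventMean μ a t) atTop (𝓝 (-1)) := by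
    have := ((h1.log (by norm_num)).add h2).sub h1
    simpa using this
  refine h3.congr' ?_
  filter_upwards [eventually_gt_atTop 0] with t ht
  rw [Real.log_mul ht.ne' (h.resolventMean_pos ha ht).ne']
  ring

/-- The integral of `η` over `(0, v)`, for any function `f` representing `η` there. -/
lemma integral_eta (h : IsSpectralLaw μ) (ha : 0 < a) {t : ℝ} (ht : 0 < t) {f : ℝ → ℝ}
    (hf : ∀ u, 0 < u → f (resolventMean μ a u) = etaParam μ a u) :
    IntegrableOn f (Ioo 0 (resolventMean μ a t)) ∧
    ∫ v in Ioo 0 (resolventMean μ a t), f v = Real.log (resolventMean μ a t)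
      + logPotential μ a t - t * resolventMean μ a t + 1 := by
  have hd : ∀ u ∈ Ioi t, HasDerivWithinAt (resolventMean μ a)
      (-∫ x, ((a * x + u)⁻¹) ^ 2 ∂μ) (Ioi t) u := fun u hu =>
    (h.hasDerivAt_resolventMean ha (ht.trans hu)).hasDerivWithinAt
  have hi : InjOn (resolventMean μ a) (Ioi t) :=
    (h.strictAntiOn_resolventMean ha).injOn.mono (Ioi_subset_Ioi ht.le)
  have hp : ∀ u ∈ Ioi t, HasDerivAt (fun t => Real.log (resolventMean μ a t) + logPotential μ a t
      - t * resolventMean μ a t) ((-∫ x, ((a * x + u)⁻¹) ^ 2 ∂μ) * etaParam μ a u) u :=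
    fun u hu => h.hasDerivAt_primitive ha (ht.trans hu)
  -- Since G' < 0 ≤ 1/G - t, the integrand has one sign, so the finite limit of the primitive
  -- already gives integrability up to infinity.
  have hn : ∀ u ∈ Ioi t, (-∫ x, ((a * x + u)⁻¹) ^ 2 ∂μ) * etaParam μ a u ≤ 0 := fun u hu =>
    mul_nonpos_of_nonpos_of_nonneg (h.deriv_resolventMean_neg ha (ht.trans hu)).le
      (h.etaParam_nonneg ha (ht.trans hu))
  have hc := (h.hasDerivAt_primitive ha ht).continuousAt.continuousWithinAt (s := Ici t)
  -- Only the values of `f` at points G(u) matter, so the lemma serves both η and the rescaled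
  -- R-transform.
  have he : EqOn (fun u => |(-∫ x, ((a * x + u)⁻¹) ^ 2 ∂μ)| • f (resolventMean μ a u))
      (fun u => -((-∫ x, ((a * x + u)⁻¹) ^ 2 ∂μ) * etaParam μ a u)) (Ioi t) := by
    intro u hu
    simp only
    rw [hf u (ht.trans hu), abs_of_neg (h.deriv_resolventMean_neg ha (ht.trans hu)), smul_eq_mul,
      neg_mul]
  rw [← h.image_Ioi_resolventMean ha ht]
  constructor
  · rw [integrableOn_image_iff_integrableOn_abs_deriv_smul measurableSet_Ioi hd hi,
      integrableOn_congr_fun he measurableSet_Ioi]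
    exact (integrableOn_Ioi_deriv_of_nonpos hc hp hn (h.tendsto_primitive ha)).neg
  · rw [integral_image_eq_integral_abs_deriv_smul measurableSet_Ioi hd hi,
      setIntegral_congr_fun measurableSet_Ioi he, integral_neg,
      integral_Ioi_of_hasDerivAt_of_nonpos hc hp hn (h.tendsto_primitive ha)]
    ring

end IsSpectralLaw

/-! ### The complex Gaussian law -/

lemma measurable_mkComplex : Measurable (fun p : ℝ × ℝ => (⟨p.1, p.2⟩ : ℂ)) :=
  Complex.measurableEquivRealProd.symm.measurable

instance isProbabilityMeasure_stdCN : IsProbabilityMeasure stdCN :=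
  Measure.isProbabilityMeasure_map measurable_mkComplex.aemeasurable

lemma stdCN_eq_withDensity : stdCN = (volume : Measure ℂ).withDensity
    (fun z => ENNReal.ofReal (Real.pi⁻¹ * Real.exp (-‖z‖ ^ 2))) := by
  have hmp : MeasurePreserving (fun p : ℝ × ℝ => (⟨p.1, p.2⟩ : ℂ)) volume volume :=
    Complex.volume_preserving_equiv_real_prod.symm
  have hd : Measurable (fun z : ℂ => ENNReal.ofReal (Real.pi⁻¹ * Real.exp (-‖z‖ ^ 2))) := by
    fun_prop
  unfold stdCN
  rw [gaussianReal_of_var_ne_zero _ (by norm_num), prod_withDensity (by fun_prop) (by fun_prop)]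
  refine Measure.ext_of_lintegral _ fun f hf => ?_
  rw [lintegral_map hf measurable_mkComplex, lintegral_withDensity_eq_lintegral_mul _ (by fun_prop)
    (show Measurable (fun p : ℝ × ℝ => f ⟨p.1, p.2⟩) from hf.comp measurable_mkComplex), lintegral_withDensity_eq_lintegral_mul _ hd hf,
    ← hmp.lintegral_comp (hd.mul hf), ← Measure.volume_eq_prod]
  refine lintegral_congr fun p => ?_
  simp only [Pi.mul_apply]
  congr 1
  rw [gaussianPDF, gaussianPDF, ← ENNReal.ofReal_mul (gaussianPDFReal_nonneg _ _ _)]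
  congr 1
  have h1 : ‖(⟨p.1, p.2⟩ : ℂ)‖ ^ 2 = p.1 ^ 2 + p.2 ^ 2 := by
    rw [← Complex.normSq_eq_norm_sq, Complex.normSq_mk]; ring
  have h2 : (√(Real.pi))⁻¹ * (√(Real.pi))⁻¹ = Real.pi⁻¹ := by
    rw [← mul_inv, Real.mul_self_sqrt Real.pi_pos.le]
  simp only [gaussianPDFReal, sub_zero]
  have h3 : 2 * Real.pi * ((1 / 2 : ℝ≥0) : ℝ) = Real.pi := by push_cast; ring
  have h4 : 2 * ((1 / 2 : ℝ≥0) : ℝ) = 1 := by push_cast; norm_num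
  rw [h3, h4, h1, div_one, div_one, ← h2, neg_add, Real.exp_add]
  ring

lemma volume_absolutelyContinuous_stdCN : (volume : Measure ℂ) ≪ stdCN := by
  rw [stdCN_eq_withDensity]
  refine withDensity_absolutelyContinuous' (by fun_prop) (Eventually.of_forall fun z => ?_)
  have : 0 < Real.pi⁻¹ * Real.exp (-‖z‖ ^ 2) := by positivity
  simpa using this

/-- Full support upgrades almost sure equality of continuous functions of the noise to equality
everywhere, as needed in `mmse_eq_zero`. -/
instance isOpenPosMeasure_stdCN : stdCN.IsOpenPosMeasure :=
  volume_absolutelyContinuous_stdCN.isOpenPosMeasure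

lemma integrable_sq_gaussian : Integrable (fun x : ℝ => x ^ 2) (gaussianReal 0 (1 / 2)) :=
  (memLp_id_gaussianReal (μ := 0) (v := 1 / 2) 2).integrable_sq

lemma integral_sq_gaussian : ∫ x : ℝ, x ^ 2 ∂(gaussianReal 0 (1 / 2)) = 1 / 2 := by
  have h := variance_id_gaussianReal (μ := 0) (v := 1 / 2)
  rw [variance_eq_sub (memLp_id_gaussianReal (μ := 0) (v := 1 / 2) 2)] at h
  simpa using h

lemma memLp_id_stdCN : MemLp (fun z : ℂ => z) 2 stdCN := by
  unfold stdCN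
  rw [memLp_map_measure_iff (by fun_prop) measurable_mkComplex.aemeasurable]
  refine (memLp_two_iff_integrable_sq_norm measurable_mkComplex.aestronglyMeasurable).2 ?_
  have : (fun p : ℝ × ℝ => ‖(⟨p.1, p.2⟩ : ℂ)‖ ^ 2) = fun p => p.1 ^ 2 + p.2 ^ 2 := by
    ext p
    rw [← Complex.normSq_eq_norm_sq, Complex.normSq_mk]; ring
  rw [this]
  exact (integrable_sq_gaussian.comp_fst _).add (integrable_sq_gaussian.comp_snd _)

lemma integral_norm_sq_stdCN : ∫ z, ‖z‖ ^ 2 ∂stdCN = 1 := by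
  unfold stdCN
  rw [integral_map measurable_mkComplex.aemeasurable (by fun_prop)]
  have : (fun p : ℝ × ℝ => ‖(⟨p.1, p.2⟩ : ℂ)‖ ^ 2) = fun p => p.1 ^ 2 + p.2 ^ 2 := by
    ext p
    rw [← Complex.normSq_eq_norm_sq, Complex.normSq_mk]; ring
  rw [this, integral_add (integrable_sq_gaussian.comp_fst _) (integrable_sq_gaussian.comp_snd _),
    integral_fun_fst (fun x : ℝ => x ^ 2), integral_fun_snd (fun x : ℝ => x ^ 2),
    integral_sq_gaussian]
  simp
  norm_num

lemma charFun_stdCN (t : ℂ) : charFun stdCN t = Complex.exp (-(‖t‖ ^ 2 : ℝ) / 4) := by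
  rw [charFun_apply, stdCN, integral_map measurable_mkComplex.aemeasurable (by fun_prop)]
  have h1 : ∀ p : ℝ × ℝ, Complex.exp ((inner ℝ (⟨p.1, p.2⟩ : ℂ) t : ℝ) * Complex.I)
      = Complex.exp (t.re * p.1 * Complex.I) * Complex.exp (t.im * p.2 * Complex.I) := by
    intro p
    rw [← Complex.exp_add, Complex.inner]
    congr 1
    simp
    ring
  simp_rw [h1]
  rw [integral_prod_mul (fun x : ℝ => Complex.exp (t.re * x * Complex.I))
    (fun x : ℝ => Complex.exp (t.im * x * Complex.I)), ← charFun_apply_real,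
    ← charFun_apply_real, charFun_gaussianReal, charFun_gaussianReal, ← Complex.exp_add,
    ← Complex.normSq_eq_norm_sq, Complex.normSq_apply]
  congr 1
  push_cast
  ring

/-- The characteristic function depends only on ‖t‖, so the law is symmetric and its mean equals its
own negative. -/
lemma integral_id_stdCN : ∫ z, z ∂stdCN = 0 := by
  have h : stdCN.map (fun z => -z) = stdCN := by
    have : IsProbabilityMeasure (stdCN.map (fun z => -z)) :=
      Measure.isProbabilityMeasure_map (by fun_prop)
    refine Measure.ext_of_charFun ?_
    ext t
    have := charFun_stdCN (-t)
    rw [charFun_apply, integral_map (by fun_prop) (by fun_prop), charFun_stdCN]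
    rw [charFun_apply] at this
    simpa using this
  have h2 : ∫ z, z ∂stdCN = -∫ z, z ∂stdCN := by
    conv_lhs => rw [← h]
    rw [integral_map (by fun_prop) (by fun_prop), integral_neg]
  have h3 : (2 : ℂ) * ∫ z, z ∂stdCN = 0 := by linear_combination h2
  simpa using h3

/-- The law `CN(0,1)` is stable. -/
lemma map_stdCN_prod (a b : ℝ) (hab : a ^ 2 + b ^ 2 = 1) :
    (stdCN.prod stdCN).map (fun p : ℂ × ℂ => (a : ℂ) * p.1 + (b : ℂ) * p.2) = stdCN := by
  have hm : Measurable (fun p : ℂ × ℂ => (a : ℂ) * p.1 + (b : ℂ) * p.2) := by fun_prop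
  have : IsProbabilityMeasure ((stdCN.prod stdCN).map
      (fun p : ℂ × ℂ => (a : ℂ) * p.1 + (b : ℂ) * p.2)) :=
    Measure.isProbabilityMeasure_map hm.aemeasurable
  refine Measure.ext_of_charFun ?_
  ext t
  rw [charFun_apply, integral_map hm.aemeasurable (by fun_prop)]
  have h1 : ∀ p : ℂ × ℂ,
      Complex.exp ((inner ℝ ((a : ℂ) * p.1 + (b : ℂ) * p.2) t : ℝ) * Complex.I)
      = Complex.exp ((inner ℝ p.1 ((a : ℂ) * t) : ℝ) * Complex.I)
        * Complex.exp ((inner ℝ p.2 ((b : ℂ) * t) : ℝ) * Complex.I) := by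
    intro p
    rw [← Complex.exp_add, Complex.inner, Complex.inner, Complex.inner]
    congr 1
    simp
    ring
  simp_rw [h1]
  rw [integral_prod_mul (fun x : ℂ => Complex.exp ((inner ℝ x ((a : ℂ) * t) : ℝ) * Complex.I))
    (fun x : ℂ => Complex.exp ((inner ℝ x ((b : ℂ) * t) : ℝ) * Complex.I)), ← charFun_apply,
    ← charFun_apply, charFun_stdCN, charFun_stdCN, charFun_stdCN, ← Complex.exp_add]
  congr 1
  simp only [norm_mul, mul_pow, Complex.norm_real, Real.norm_eq_abs, sq_abs]
  have hab' : (a : ℂ) ^ 2 + (b : ℂ) ^ 2 = 1 := by exact_mod_cast hab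
  push_cast
  linear_combination (-(‖t‖ : ℂ) ^ 2 / 4) * hab'

/-! ### The scalar channel and its posterior mean -/

/-- The likelihood of `x` given the output `y` of the channel with amplitude `s`, up to `π⁻¹`. -/
def likelihood (s : ℝ) (x y : ℂ) : ℝ := Real.exp (-‖y - s * x‖ ^ 2)

/-- The density of the output, up to `π⁻¹`. -/
def evidence (P : Measure ℂ) (s : ℝ) (y : ℂ) : ℝ := ∫ x, likelihood s x y ∂P

/-- The posterior mean of `h x` given the output `y`. -/
def postMean (P : Measure ℂ) (s : ℝ) (h : ℂ → ℂ) (y : ℂ) : ℂ :=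
  ((evidence P s y)⁻¹ : ℝ) * ∫ x, (likelihood s x y : ℂ) * h x ∂P

/-- The channel output. -/
def output (s : ℝ) (p : ℂ × ℂ) : ℂ := s * p.1 + p.2

lemma likelihood_pos (s : ℝ) (x y : ℂ) : 0 < likelihood s x y := Real.exp_pos _

lemma likelihood_le_one (s : ℝ) (x y : ℂ) : likelihood s x y ≤ 1 :=
  Real.exp_le_one_iff.2 (by simp)

lemma continuous_likelihood : Continuous fun q : ℝ × ℂ × ℂ => likelihood q.1 q.2.1 q.2.2 := by
  unfold likelihood
  fun_prop

@[fun_prop]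
lemma measurable_likelihood (s : ℝ) : Measurable fun p : ℂ × ℂ => likelihood s p.1 p.2 := by
  unfold likelihood
  fun_prop

@[fun_prop]
lemma measurable_likelihood_left (s : ℝ) (y : ℂ) : Measurable fun x => likelihood s x y := by
  unfold likelihood
  fun_prop

@[fun_prop]
lemma measurable_output (s : ℝ) : Measurable (output s) := by
  unfold output
  fun_prop

variable {P : Measure ℂ}

lemma integrable_likelihood [IsProbabilityMeasure P] (s : ℝ) (y : ℂ) :
    Integrable (fun x => likelihood s x y) P :=
  Integrable.of_bound (C := 1) (by fun_prop) (Eventually.of_forall fun x => by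
    rw [Real.norm_of_nonneg (likelihood_pos s x y).le]; exact likelihood_le_one s x y)

lemma evidence_pos [IsProbabilityMeasure P] (s : ℝ) (y : ℂ) : 0 < evidence P s y := by
  refine (integral_pos_iff_support_of_nonneg (fun x => (likelihood_pos s x y).le)
    (integrable_likelihood s y)).2 ?_
  have : Function.support (fun x => likelihood s x y) = univ := by
    ext x; simp [(likelihood_pos s x y).ne']
  rw [this]
  simp

lemma evidence_le_one [IsProbabilityMeasure P] (s : ℝ) (y : ℂ) : evidence P s y ≤ 1 := by
  have := integral_mono (integrable_likelihood (P := P) s y) (integrable_const 1)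
    (fun x => likelihood_le_one s x y)
  simpa [evidence] using this

lemma measurable_evidence [IsProbabilityMeasure P] (s : ℝ) : Measurable (evidence P s) := by
  have : StronglyMeasurable (fun p : ℂ × ℂ => likelihood s p.2 p.1) :=
    ((measurable_likelihood s).comp measurable_swap).stronglyMeasurable
  exact (this.integral_prod_right (ν := P)).measurable

lemma measurable_postMean [IsProbabilityMeasure P] (s : ℝ) {h : ℂ → ℂ} (hh : Measurable h) :
    Measurable (postMean P s h) := by
  have : StronglyMeasurable (fun p : ℂ × ℂ => (likelihood s p.2 p.1 : ℂ) * h p.2) :=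
    Measurable.stronglyMeasurable (by
      have := (measurable_likelihood s).comp measurable_swap
      exact (Complex.measurable_ofReal.comp this).mul (hh.comp measurable_snd))
  exact (Complex.measurable_ofReal.comp (measurable_evidence s).inv).mul
    (this.integral_prod_right (ν := P)).measurable

/-- The joint law of input and output. -/
lemma map_input_output [IsProbabilityMeasure P] (s : ℝ) :
    (P.prod stdCN).map (fun p => (p.1, output s p))
      = (P.prod (volume : Measure ℂ)).withDensity
        (fun p => ENNReal.ofReal (Real.pi⁻¹ * likelihood s p.1 p.2)) := by
  have hm : Measurable (fun p : ℂ × ℂ => (p.1, output s p)) := by fun_prop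
  refine Measure.ext_of_lintegral _ fun f hf => ?_
  rw [lintegral_map hf hm, lintegral_withDensity_eq_lintegral_mul _ (by fun_prop) hf,
    lintegral_prod (fun p : ℂ × ℂ => f (p.1, output s p)) (hf.comp hm).aemeasurable,
    lintegral_prod _ (by fun_prop)]
  refine lintegral_congr fun x => ?_
  have hfx : Measurable (fun z : ℂ => f (x, output s (x, z))) := by fun_prop
  rw [stdCN_eq_withDensity, lintegral_withDensity_eq_lintegral_mul _ (by fun_prop) hfx]
  -- For fixed x, passing from the noise z to the output y is a translation by s x, which preserves
  -- Lebesgue measure.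
  refine Eq.trans ?_ (lintegral_add_left_eq_self (μ := (volume : Measure ℂ))
      (fun y => ((fun p : ℂ × ℂ => ENNReal.ofReal (Real.pi⁻¹ * likelihood s p.1 p.2)) * f) (x, y))
      ((s : ℂ) * x))
  refine lintegral_congr fun z => ?_
  simp [likelihood, output]

/-- Passing to Lebesgue measure in the output makes the two variables a product, so that Fubini can
integrate over the input first. -/
lemma integrable_output_iff [IsProbabilityMeasure P] (s : ℝ) {E : Type*} [NormedAddCommGroup E]
    [NormedSpace ℝ E] {f : ℂ × ℂ → E} (hf : StronglyMeasurable f) :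
    Integrable (fun p => f (p.1, output s p)) (P.prod stdCN)
      ↔ Integrable (fun p => (Real.pi⁻¹ * likelihood s p.1 p.2) • f p)
        (P.prod (volume : Measure ℂ)) := by
  have hm : Measurable (fun p : ℂ × ℂ => (p.1, output s p)) := by fun_prop
  have h1 := integrable_map_measure (μ := P.prod stdCN) (f := fun p => (p.1, output s p))
    hf.aestronglyMeasurable hm.aemeasurable
  rw [map_input_output, integrable_withDensity_iff_integrable_smul₀' (by fun_prop)
    (by simp)] at h1
  refine h1.symm.trans (integrable_congr (Eventually.of_forall fun p => ?_))
  have : 0 ≤ Real.pi⁻¹ * likelihood s p.1 p.2 :=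
    mul_nonneg (by positivity) (likelihood_pos _ _ _).le
  simp only [ENNReal.toReal_ofReal this]

lemma integral_output_eq [IsProbabilityMeasure P] (s : ℝ) {E : Type*} [NormedAddCommGroup E]
    [NormedSpace ℝ E] {f : ℂ × ℂ → E} (hf : StronglyMeasurable f) :
    ∫ p, f (p.1, output s p) ∂(P.prod stdCN)
      = ∫ p, (Real.pi⁻¹ * likelihood s p.1 p.2) • f p ∂(P.prod (volume : Measure ℂ)) := by
  have hm : Measurable (fun p : ℂ × ℂ => (p.1, output s p)) := by fun_prop
  rw [← integral_map (φ := fun p : ℂ × ℂ => (p.1, output s p)) hm.aemeasurable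
    hf.aestronglyMeasurable, map_input_output,
    integral_withDensity_eq_integral_toReal_smul (by fun_prop) (by simp)]
  refine integral_congr_ae (Eventually.of_forall fun p => ?_)
  have : 0 ≤ Real.pi⁻¹ * likelihood s p.1 p.2 :=
    mul_nonneg (by positivity) (likelihood_pos _ _ _).le
  simp only [ENNReal.toReal_ofReal this]

/-- The tower property: `E[F(y) h(x)] = E[F(y) E[h(x) | y]]`. -/
lemma integral_mul_postMean [IsProbabilityMeasure P] (s : ℝ) {F h : ℂ → ℂ} (hF : Measurable F)
    (hh : Measurable h)
    (hi : Integrable (fun p => F (output s p) * h p.1) (P.prod stdCN)) :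
    Integrable (fun p => F (output s p) * postMean P s h (output s p)) (P.prod stdCN) ∧
    ∫ p, F (output s p) * postMean P s h (output s p) ∂(P.prod stdCN)
      = ∫ p, F (output s p) * h p.1 ∂(P.prod stdCN) := by
  have hm1 : StronglyMeasurable (fun p : ℂ × ℂ => F p.2 * h p.1) :=
    Measurable.stronglyMeasurable (by fun_prop)
  have hm2 : StronglyMeasurable (fun p : ℂ × ℂ => F p.2 * postMean P s h p.2) :=
    Measurable.stronglyMeasurable
      ((hF.comp measurable_snd).mul ((measurable_postMean s hh).comp measurable_snd))
  have hm3 : StronglyMeasurable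
      (fun p : ℂ × ℂ => (Real.pi⁻¹ * likelihood s p.1 p.2) • (F p.2 * postMean P s h p.2)) :=
    Measurable.stronglyMeasurable
      (((measurable_const).mul (measurable_likelihood s)).smul hm2.measurable)
  have hK := (integrable_output_iff (P := P) s hm1).1 hi
  have hin : ∀ y, ∫ x, (Real.pi⁻¹ * likelihood s x y) • (F y * h x) ∂P
      = ((Real.pi⁻¹ * evidence P s y : ℝ) : ℂ) * (F y * postMean P s h y) := by
    intro y
    have h1 : ∀ x, (Real.pi⁻¹ * likelihood s x y) • (F y * h x)
        = ((Real.pi⁻¹ : ℝ) : ℂ) * F y * ((likelihood s x y : ℂ) * h x) := by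
      intro x
      rw [Complex.real_smul]
      push_cast
      ring
    have h2 : (evidence P s y : ℂ) ≠ 0 := by exact_mod_cast (evidence_pos s y).ne'
    simp_rw [h1]
    rw [integral_const_mul, postMean]
    push_cast
    field_simp
  have hin2 : ∀ y (c : ℂ), ∫ x, (Real.pi⁻¹ * likelihood s x y) • c ∂P
      = ((Real.pi⁻¹ * evidence P s y : ℝ) : ℂ) * c := by
    intro y c
    rw [integral_smul_const, integral_const_mul, Complex.real_smul]
    rfl
  have hi2 : Integrable
      (fun p : ℂ × ℂ => (Real.pi⁻¹ * likelihood s p.1 p.2) • (F p.2 * postMean P s h p.2))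
      (P.prod (volume : Measure ℂ)) := by
    rw [integrable_prod_iff' hm3.aestronglyMeasurable]
    refine ⟨Eventually.of_forall fun y =>
      ((integrable_likelihood s y).const_mul Real.pi⁻¹).smul_const (F y * postMean P s h y), ?_⟩
    -- By `hin`, averaging the new integrand's norm over x gives the norm of the x-average of the
    -- old integrand, which is integrable in y.
    refine hK.integral_prod_right.norm.congr (Eventually.of_forall fun y => ?_)
    simp only
    rw [hin]
    have h0 : ∀ x, ‖(Real.pi⁻¹ * likelihood s x y) • (F y * postMean P s h y)‖
        = (Real.pi⁻¹ * likelihood s x y) * ‖F y * postMean P s h y‖ := by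
      intro x
      rw [norm_smul, Real.norm_of_nonneg (mul_nonneg (by positivity) (likelihood_pos _ _ _).le)]
    simp_rw [h0]
    rw [integral_mul_const, integral_const_mul, norm_mul, Complex.norm_real,
      Real.norm_of_nonneg (mul_nonneg (by positivity) (evidence_pos _ _).le)]
    rfl
  refine ⟨(integrable_output_iff (P := P) s hm2).2 hi2, ?_⟩
  rw [integral_output_eq s hm1, integral_output_eq s hm2, integral_prod_symm _ hK,
    integral_prod_symm _ hi2]
  refine integral_congr_ae (Eventually.of_forall fun y => ?_)
  simp only
  rw [hin, hin2]

/-! ### The scalar MMSE -/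

/-- A probability law with unit power. -/
structure IsSignalLaw (P : Measure ℂ) : Prop where
  prob : IsProbabilityMeasure P
  power : ∫ x, ‖x‖ ^ 2 ∂P = 1

/-- The conditional mean estimate of the input given the output `y`. -/
def estimate (P : Measure ℂ) (s : ℝ) (y : ℂ) : ℂ := postMean P s (fun x => x) y

/-- The posterior mean of `‖x‖ ^ 2` given the output `y`. -/
def postPower (P : Measure ℂ) (s : ℝ) (y : ℂ) : ℝ :=
  (evidence P s y)⁻¹ * ∫ x, likelihood s x y * ‖x‖ ^ 2 ∂P

/-- The minimum mean square error at amplitude `s`. -/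
def mmse (P : Measure ℂ) (s : ℝ) : ℝ :=
  ∫ p, ‖p.1 - estimate P s (output s p)‖ ^ 2 ∂(P.prod stdCN)

/-! ### Second-order calculus for square-integrable complex functions -/

section Square

variable {α : Type*} [MeasurableSpace α] {ν : Measure α} {f g : α → ℂ}

lemma integrable_conj_mul (hf : MemLp f 2 ν) (hg : MemLp g 2 ν) :
    Integrable (fun p => (starRingEnd ℂ) (f p) * g p) ν :=
  hf.star.integrable_mul hg

lemma integrable_inner_of_memLp (hf : MemLp f 2 ν) (hg : MemLp g 2 ν) :
    Integrable (fun p => (inner ℝ (f p) (g p) : ℝ)) ν := by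
  simpa [Complex.inner, mul_comm] using (integrable_conj_mul hf hg).re

lemma integral_inner_eq_re (hf : MemLp f 2 ν) (hg : MemLp g 2 ν) :
    ∫ p, (inner ℝ (f p) (g p) : ℝ) ∂ν = (∫ p, (starRingEnd ℂ) (f p) * g p ∂ν).re := by
  have := integral_re (integrable_conj_mul hf hg)
  simp only [Complex.inner, mul_comm (g _)]
  exact this

lemma integrable_norm_sq (hf : MemLp f 2 ν) : Integrable (fun p => ‖f p‖ ^ 2) ν :=
  (memLp_two_iff_integrable_sq_norm hf.1).1 hf

lemma integral_norm_sub_sq (hf : MemLp f 2 ν) (hg : MemLp g 2 ν) :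
    ∫ p, ‖f p - g p‖ ^ 2 ∂ν
      = ∫ p, ‖f p‖ ^ 2 ∂ν - 2 * ∫ p, (inner ℝ (g p) (f p) : ℝ) ∂ν + ∫ p, ‖g p‖ ^ 2 ∂ν := by
  have h1 : ∀ p, ‖f p - g p‖ ^ 2
      = (‖f p‖ ^ 2 - 2 * (inner ℝ (g p) (f p) : ℝ)) + ‖g p‖ ^ 2 := fun p => by
    rw [norm_sub_sq_real, real_inner_comm]
  have hI := (integrable_inner_of_memLp hg hf).const_mul 2
  have hJ : Integrable (fun p => ‖f p‖ ^ 2 - 2 * (inner ℝ (g p) (f p) : ℝ)) ν :=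
    (integrable_norm_sq hf).sub hI
  simp_rw [h1]
  rw [integral_add hJ (integrable_norm_sq hg), integral_sub (integrable_norm_sq hf) hI,
    integral_const_mul]

end Square

/-- The likelihood is at most 1, so the norm of `h` dominates. This gives joint continuity in
amplitude and output of the evidence, the estimate and the posterior power. -/
lemma continuous_integral_likelihood [IsProbabilityMeasure P] {E : Type*} [NormedAddCommGroup E]
    [NormedSpace ℝ E] {h : ℂ → E} (hh : Integrable h P) :
    Continuous fun q : ℝ × ℂ => ∫ x, likelihood q.1 x q.2 • h x ∂P := by
  refine continuous_of_dominated (bound := fun x => ‖h x‖) (fun q => ?_) (fun q => ?_) hh.norm ?_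
  · exact (measurable_likelihood_left q.1 q.2).aestronglyMeasurable.smul hh.1
  · refine Eventually.of_forall fun x => ?_
    rw [norm_smul, Real.norm_of_nonneg (likelihood_pos _ _ _).le]
    exact mul_le_of_le_one_left (norm_nonneg _) (likelihood_le_one _ _ _)
  · refine Eventually.of_forall fun x => ?_
    have : Continuous fun q : ℝ × ℂ => likelihood q.1 x q.2 :=
      continuous_likelihood.comp (by fun_prop : Continuous fun q : ℝ × ℂ => (q.1, x, q.2))
    exact this.smul continuous_const

lemma continuous_evidence [IsProbabilityMeasure P] :
    Continuous fun q : ℝ × ℂ => evidence P q.1 q.2 := by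
  simpa [evidence] using continuous_integral_likelihood (P := P) (integrable_const (1 : ℝ))

/-- Fatou's lemma for Bochner integrals. -/
lemma eventually_lt_integral {α : Type*} [MeasurableSpace α] {ν : Measure α} {f : ℕ → α → ℝ}
    {g : α → ℝ} (hf : ∀ n, Integrable (f n) ν) (hg : Integrable g ν) (hf0 : ∀ n x, 0 ≤ f n x)
    (hlim : ∀ x, Tendsto (fun n => f n x) atTop (𝓝 (g x))) {c : ℝ} (hc : c < ∫ x, g x ∂ν) :
    ∀ᶠ n in atTop, c < ∫ x, f n x ∂ν := by
  -- Negative levels are treated apart because `ENNReal.ofReal` collapses them to 0.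
  rcases lt_or_ge c 0 with h | h
  · exact Eventually.of_forall fun n => h.trans_le (integral_nonneg (hf0 n))
  have hg0 : ∀ x, 0 ≤ g x := fun x => ge_of_tendsto' (hlim x) fun n => hf0 n x
  have h1 : ENNReal.ofReal (∫ x, g x ∂ν)
      ≤ liminf (fun n => ENNReal.ofReal (∫ x, f n x ∂ν)) atTop := by
    rw [ofReal_integral_eq_lintegral_ofReal hg (Eventually.of_forall hg0)]
    have h2 : ∀ x, ENNReal.ofReal (g x) = liminf (fun n => ENNReal.ofReal (f n x)) atTop :=
      fun x => ((ENNReal.tendsto_ofReal (hlim x)).liminf_eq).symm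
    simp_rw [h2]
    refine (lintegral_liminf_le' fun n => (hf n).1.aemeasurable.ennreal_ofReal).trans ?_
    refine le_of_eq ?_
    congr 1
    ext n
    rw [ofReal_integral_eq_lintegral_ofReal (hf n) (Eventually.of_forall (hf0 n))]
  have h3 : ENNReal.ofReal c < liminf (fun n => ENNReal.ofReal (∫ x, f n x ∂ν)) atTop :=
    ((ENNReal.ofReal_lt_ofReal_iff_of_nonneg h).2 hc).trans_le h1
  filter_upwards [eventually_lt_of_lt_liminf h3] with n hn
  exact (ENNReal.ofReal_lt_ofReal_iff_of_nonneg h).1 hn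

/-! ### Orthogonality, extremality, continuity and monotonicity of the scalar MMSE -/

namespace IsSignalLaw

/-- The Bochner integral of a non-integrable function is 0, so a power equal to 1 already forces
integrability. -/
lemma memLp_id (h : IsSignalLaw P) : MemLp (fun x : ℂ => x) 2 P := by
  refine (memLp_two_iff_integrable_sq_norm (by fun_prop)).2 ?_
  by_contra hc
  have := h.power
  rw [integral_undef hc] at this
  norm_num at this

lemma memLp_input (h : IsSignalLaw P) : MemLp (fun p : ℂ × ℂ => p.1) 2 (P.prod stdCN) := by
  have := h.prob
  exact h.memLp_id.comp_fst stdCN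

lemma memLp_noise (h : IsSignalLaw P) : MemLp (fun p : ℂ × ℂ => p.2) 2 (P.prod stdCN) := by
  have := h.prob
  exact memLp_id_stdCN.comp_snd P

lemma memLp_output (h : IsSignalLaw P) (s : ℝ) : MemLp (output s) 2 (P.prod stdCN) :=
  (h.memLp_input.const_mul (s : ℂ)).add h.memLp_noise

lemma integral_norm_sq_input (h : IsSignalLaw P) :
    ∫ p, ‖p.1‖ ^ 2 ∂(P.prod stdCN) = 1 := by
  have := h.prob
  rw [integral_fun_fst (fun x : ℂ => ‖x‖ ^ 2), h.power]
  simp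

lemma integral_norm_sq_noise (h : IsSignalLaw P) :
    ∫ p, ‖p.2‖ ^ 2 ∂(P.prod stdCN) = 1 := by
  have := h.prob
  rw [integral_fun_snd (fun x : ℂ => ‖x‖ ^ 2), integral_norm_sq_stdCN]
  simp

lemma integral_inner_noise_input (h : IsSignalLaw P) :
    ∫ p, (inner ℝ p.2 p.1 : ℝ) ∂(P.prod stdCN) = 0 := by
  have := h.prob
  rw [integral_inner_eq_re h.memLp_noise h.memLp_input]
  have h1 : ∀ p : ℂ × ℂ, (starRingEnd ℂ) p.2 * p.1 = p.1 * (starRingEnd ℂ) p.2 :=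
    fun p => mul_comm _ _
  simp_rw [h1]
  rw [integral_prod_mul (fun x : ℂ => x) (fun z : ℂ => (starRingEnd ℂ) z), integral_conj,
    integral_id_stdCN]
  simp

lemma integrable_likelihood_mul (h : IsSignalLaw P) (s : ℝ) (y : ℂ) :
    Integrable (fun x => (likelihood s x y : ℂ) * x) P := by
  have := h.prob
  refine (h.memLp_id.integrable one_le_two).bdd_mul (c := 1)
    (Complex.measurable_ofReal.comp (measurable_likelihood_left s y)).aestronglyMeasurable
    (Eventually.of_forall fun x => ?_)
  rw [Complex.norm_real, Real.norm_of_nonneg (likelihood_pos _ _ _).le]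
  exact likelihood_le_one _ _ _

lemma integrable_likelihood_mul_sq (h : IsSignalLaw P) (s : ℝ) (y : ℂ) :
    Integrable (fun x => likelihood s x y * ‖x‖ ^ 2) P := by
  have := h.prob
  refine (integrable_norm_sq h.memLp_id).bdd_mul (c := 1)
    (measurable_likelihood_left s y).aestronglyMeasurable
    (Eventually.of_forall fun x => ?_)
  rw [Real.norm_of_nonneg (likelihood_pos _ _ _).le]
  exact likelihood_le_one _ _ _

lemma continuous_estimate (h : IsSignalLaw P) :
    Continuous fun q : ℝ × ℂ => estimate P q.1 q.2 := by
  have := h.prob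
  have h1 := continuous_integral_likelihood (h.memLp_id.integrable one_le_two)
  have h2 := (continuous_evidence (P := P)).inv₀ fun q => (evidence_pos q.1 q.2).ne'
  simp only [Complex.real_smul] at h1
  unfold estimate postMean
  exact (Complex.continuous_ofReal.comp h2).mul h1

lemma continuous_postPower (h : IsSignalLaw P) :
    Continuous fun q : ℝ × ℂ => postPower P q.1 q.2 := by
  have := h.prob
  have h1 := continuous_integral_likelihood (integrable_norm_sq h.memLp_id)
  have h2 := (continuous_evidence (P := P)).inv₀ fun q => (evidence_pos q.1 q.2).ne'
  exact h2.mul h1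

lemma continuous_estimate_right (h : IsSignalLaw P) (s : ℝ) : Continuous (estimate P s) := by
  have h1 : Continuous fun y : ℂ => (s, y) := by fun_prop
  have h2 := h.continuous_estimate.comp h1
  exact h2

/-- This form lets the complex tower property compute the mean posterior power, with constant weight
`F` = 1. -/
lemma ofReal_postPower (s : ℝ) (y : ℂ) :
    (postPower P s y : ℂ) = postMean P s (fun x => ((‖x‖ ^ 2 : ℝ) : ℂ)) y := by
  simp only [postPower, postMean]
  rw [Complex.ofReal_mul, ← integral_complex_ofReal]
  simp only [Complex.ofReal_mul]

lemma integrable_postPower (h : IsSignalLaw P) (s : ℝ) :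
    Integrable (fun p => postPower P s (output s p)) (P.prod stdCN) ∧
    ∫ p, postPower P s (output s p) ∂(P.prod stdCN) = 1 := by
  have := h.prob
  have hi : Integrable (fun p : ℂ × ℂ => (1 : ℂ) * ((‖p.1‖ ^ 2 : ℝ) : ℂ)) (P.prod stdCN) := by
    simpa using (integrable_norm_sq h.memLp_input).ofReal (𝕜 := ℂ)
  obtain ⟨h1, h2⟩ := integral_mul_postMean (P := P) s (F := fun _ => 1)
    (h := fun x => ((‖x‖ ^ 2 : ℝ) : ℂ)) measurable_const (by fun_prop) hi
  simp only [one_mul, ← ofReal_postPower] at h1 h2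
  refine ⟨by simpa using h1.re, ?_⟩
  rw [integral_complex_ofReal, integral_complex_ofReal, h.integral_norm_sq_input] at h2
  exact_mod_cast h2

/-- The posterior variance identity. -/
lemma integral_likelihood_norm_sub_sq (h : IsSignalLaw P) (s : ℝ) (y : ℂ) :
    ∫ x, likelihood s x y * ‖x - estimate P s y‖ ^ 2 ∂P
      = evidence P s y * (postPower P s y - ‖estimate P s y‖ ^ 2) := by
  have := h.prob
  set c := estimate P s y with hc
  have hg := (evidence_pos (P := P) s y).ne'
  have h1 : ∀ x, likelihood s x y * ‖x - c‖ ^ 2 = (likelihood s x y * ‖x‖ ^ 2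
      - 2 * ((starRingEnd ℂ) c * ((likelihood s x y : ℂ) * x)).re) + likelihood s x y * ‖c‖ ^ 2 := by
    intro x
    rw [norm_sub_sq_real, real_inner_comm, Complex.inner, mul_comm x]
    have : ((starRingEnd ℂ) c * ((likelihood s x y : ℂ) * x)).re
        = likelihood s x y * ((starRingEnd ℂ) c * x).re := by
      rw [← Complex.re_ofReal_mul]; congr 1; ring
    rw [this]
    ring
  have hI := (h.integrable_likelihood_mul s y).const_mul ((starRingEnd ℂ) c)
  have hI2 : Integrable (fun x => 2 * ((starRingEnd ℂ) c * ((likelihood s x y : ℂ) * x)).re) P :=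
    hI.re.const_mul 2
  have hJ : Integrable (fun x => likelihood s x y * ‖x‖ ^ 2
      - 2 * ((starRingEnd ℂ) c * ((likelihood s x y : ℂ) * x)).re) P :=
    (h.integrable_likelihood_mul_sq s y).sub hI2
  have h2 : ∫ x, ((starRingEnd ℂ) c * ((likelihood s x y : ℂ) * x)).re ∂P
      = evidence P s y * ‖c‖ ^ 2 := by
    have h3 := integral_re hI
    refine h3.trans ?_
    have h4 : ∫ x, (likelihood s x y : ℂ) * x ∂P = (evidence P s y : ℂ) * c := by
      have : (evidence P s y : ℂ) ≠ 0 := by exact_mod_cast hg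
      rw [hc, estimate, postMean]
      push_cast
      field_simp
    rw [integral_const_mul, h4]
    have h5 : (starRingEnd ℂ) c * ((evidence P s y : ℂ) * c)
        = ((evidence P s y * ‖c‖ ^ 2 : ℝ) : ℂ) := by
      push_cast
      rw [← Complex.conj_mul' c]
      ring
    rw [h5]
    exact Complex.ofReal_re _
  have h6 : ∫ x, likelihood s x y * ‖x‖ ^ 2 ∂P = evidence P s y * postPower P s y := by
    rw [postPower]
    field_simp
  simp_rw [h1]
  rw [integral_add hJ ((integrable_likelihood s y).mul_const _),
    integral_sub (h.integrable_likelihood_mul_sq s y) hI2, integral_const_mul, h2, h6,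
    integral_mul_const]
  change _ + evidence P s y * _ = _
  ring

/-- The posterior variance is nonnegative. The bound puts the estimate in L² and provides the
nonnegative integrand for Fatou in `continuous_mmse`. -/
lemma norm_sq_estimate_le (h : IsSignalLaw P) (s : ℝ) (y : ℂ) :
    ‖estimate P s y‖ ^ 2 ≤ postPower P s y := by
  have := h.prob
  have h1 := h.integral_likelihood_norm_sub_sq s y
  have h2 : 0 ≤ ∫ x, likelihood s x y * ‖x - estimate P s y‖ ^ 2 ∂P :=
    integral_nonneg fun x => mul_nonneg (likelihood_pos _ _ _).le (sq_nonneg _)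
  rw [h1] at h2
  have := nonneg_of_mul_nonneg_right h2 (evidence_pos s y)
  linarith

lemma memLp_estimate (h : IsSignalLaw P) (s : ℝ) :
    MemLp (fun p => estimate P s (output s p)) 2 (P.prod stdCN) := by
  have hm : AEStronglyMeasurable (fun p => estimate P s (output s p)) (P.prod stdCN) :=
    ((h.continuous_estimate_right s).measurable.comp (measurable_output s)).aestronglyMeasurable
  refine (memLp_two_iff_integrable_sq_norm hm).2 ?_
  refine (h.integrable_postPower s).1.mono' (hm.norm.pow 2) (Eventually.of_forall fun p => ?_)
  rw [Real.norm_of_nonneg (sq_nonneg _)]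
  exact h.norm_sq_estimate_le s _

/-- Orthogonality of the estimation error to functions of the output. -/
lemma integral_inner_estimate (h : IsSignalLaw P) (s : ℝ) {ψ : ℂ → ℂ} (hψ : Measurable ψ)
    (hL : MemLp (fun p => ψ (output s p)) 2 (P.prod stdCN)) :
    ∫ p, (inner ℝ (ψ (output s p)) (estimate P s (output s p)) : ℝ) ∂(P.prod stdCN)
      = ∫ p, (inner ℝ (ψ (output s p)) p.1 : ℝ) ∂(P.prod stdCN) := by
  have := h.prob
  rw [integral_inner_eq_re hL (h.memLp_estimate s), integral_inner_eq_re hL h.memLp_input]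
  congr 1
  exact (integral_mul_postMean (P := P) s (F := fun y => (starRingEnd ℂ) (ψ y))
    (h := fun x => x) (by fun_prop) measurable_id (integrable_conj_mul hL h.memLp_input)).2

/-- Pythagoras: the error is orthogonal to the estimate, itself a function of the output. -/
lemma mmse_eq (h : IsSignalLaw P) (s : ℝ) :
    mmse P s = 1 - ∫ p, ‖estimate P s (output s p)‖ ^ 2 ∂(P.prod stdCN) := by
  have h1 := h.integral_inner_estimate s (h.continuous_estimate_right s).measurable
    (h.memLp_estimate s)
  simp only [real_inner_self_eq_norm_sq] at h1
  rw [mmse, integral_norm_sub_sq h.memLp_input (h.memLp_estimate s), ← h1,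
    h.integral_norm_sq_input]
  ring

lemma mmse_nonneg (P : Measure ℂ) (s : ℝ) : 0 ≤ mmse P s := integral_nonneg fun _ => sq_nonneg _

/-- The posterior mean minimizes the mean square error. -/
lemma mmse_le (h : IsSignalLaw P) (s : ℝ) {ψ : ℂ → ℂ} (hψ : Measurable ψ)
    (hi : Integrable (fun p => ‖p.1 - ψ (output s p)‖ ^ 2) (P.prod stdCN)) :
    mmse P s ≤ ∫ p, ‖p.1 - ψ (output s p)‖ ^ 2 ∂(P.prod stdCN) := by
  have hL : MemLp (fun p => ψ (output s p)) 2 (P.prod stdCN) := by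
    have h1 : MemLp (fun p : ℂ × ℂ => p.1 - ψ (output s p)) 2 (P.prod stdCN) :=
      (memLp_two_iff_integrable_sq_norm (Measurable.aestronglyMeasurable (by fun_prop))).2 hi
    have := h.memLp_input.sub h1
    convert this using 1
    ext p
    simp
  -- By orthogonality, this squared distance from ψ to the estimate is exactly the excess error of
  -- ψ.
  have h2 : 0 ≤ ∫ p, ‖ψ (output s p) - estimate P s (output s p)‖ ^ 2 ∂(P.prod stdCN) :=
    integral_nonneg fun _ => sq_nonneg _
  rw [integral_norm_sub_sq hL (h.memLp_estimate s)] at h2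
  rw [integral_norm_sub_sq h.memLp_input hL, h.mmse_eq, h.integral_norm_sq_input,
    ← h.integral_inner_estimate s hψ hL]
  simp_rw [real_inner_comm (estimate P s _) (ψ _)] at *
  linarith

/-- The competitor is the linear estimator y ↦ s y / (1 + s²); its error uses only second moments
and the uncorrelated, centred noise. -/
lemma mmse_le_inv (h : IsSignalLaw P) (s : ℝ) : mmse P s ≤ (1 + s ^ 2)⁻¹ := by
  have hs : 0 < 1 + s ^ 2 := by positivity
  set c : ℝ := s / (1 + s ^ 2) with hc
  have hL : MemLp (fun p => (c : ℂ) * output s p) 2 (P.prod stdCN) :=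
    (h.memLp_output s).const_mul _
  refine (h.mmse_le s (ψ := fun y => (c : ℂ) * y) (by fun_prop)
    (integrable_norm_sq (h.memLp_input.sub hL))).trans (le_of_eq ?_)
  have h1 : ∀ p : ℂ × ℂ, ‖p.1 - (c : ℂ) * output s p‖ ^ 2
      = ‖((1 - c * s : ℝ) : ℂ) * p.1 - (c : ℂ) * p.2‖ ^ 2 := by
    intro p
    congr 2
    simp only [output]
    push_cast
    ring
  simp_rw [h1]
  rw [integral_norm_sub_sq (h.memLp_input.const_mul _) (h.memLp_noise.const_mul _)]
  have h2 : ∀ p : ℂ × ℂ, (inner ℝ ((c : ℂ) * p.2) (((1 - c * s : ℝ) : ℂ) * p.1) : ℝ)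
      = (c * (1 - c * s)) * (inner ℝ p.2 p.1 : ℝ) := by
    intro p
    rw [← Complex.real_smul, ← Complex.real_smul, real_inner_smul_left, real_inner_smul_right]
    ring
  simp_rw [h2, norm_mul, mul_pow, Complex.norm_real, Real.norm_eq_abs, sq_abs]
  rw [integral_const_mul, integral_const_mul, integral_const_mul, h.integral_inner_noise_input,
    h.integral_norm_sq_input, h.integral_norm_sq_noise, hc]
  field_simp
  ring

/-- Zero error means that x is recovered from almost every output. As the noise has full support and
the estimate is continuous, almost every x equals the estimate at y = 0, so P is a point mass and a
constant estimator is exact at every amplitude. -/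
lemma mmse_eq_zero (h : IsSignalLaw P) {s : ℝ} (hs : mmse P s = 0) (s' : ℝ) : mmse P s' = 0 := by
  have := h.prob
  have hi : Integrable (fun p => ‖p.1 - estimate P s (output s p)‖ ^ 2) (P.prod stdCN) :=
    integrable_norm_sq (h.memLp_input.sub (h.memLp_estimate s))
  have h1 : ∀ᵐ p ∂(P.prod stdCN), p.1 = estimate P s (output s p) := by
    rw [mmse, integral_eq_zero_iff_of_nonneg (fun _ => sq_nonneg _) hi] at hs
    filter_upwards [hs] with p hp
    have : ‖p.1 - estimate P s (output s p)‖ = 0 := by simpa using hp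
    exact sub_eq_zero.1 (norm_eq_zero.1 this)
  have h2 : ∀ᵐ x ∂P, ∀ y, estimate P s y = x := by
    filter_upwards [Measure.ae_ae_of_ae_prod h1] with x hx y
    have h3 : (fun z : ℂ => estimate P s (output s (x, z))) =ᵐ[stdCN] fun _ => x := by
      filter_upwards [hx] with z hz using hz.symm
    have hc : Continuous fun z : ℂ => estimate P s (output s (x, z)) :=
      (h.continuous_estimate_right s).comp (by unfold output; fun_prop)
    have := congrFun ((hc.ae_eq_iff_eq stdCN continuous_const).1 h3) (y - s * x)
    simpa [output] using this
  obtain ⟨x₀, hx₀⟩ := h2.exists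
  have h4 : ∀ᵐ x ∂P, x = x₀ := by
    filter_upwards [h2] with x hx
    rw [← hx 0, hx₀ 0]
  have h5 : ∀ᵐ p ∂(P.prod stdCN), ‖p.1 - x₀‖ ^ 2 = 0 := by
    have := Measure.quasiMeasurePreserving_fst (μ := P) (ν := stdCN) |>.ae h4
    filter_upwards [this] with p hp
    simp [hp]
  refine le_antisymm ?_ (mmse_nonneg P s')
  have h6 : ∫ p, ‖p.1 - x₀‖ ^ 2 ∂(P.prod stdCN) = 0 := integral_eq_zero_of_ae h5
  rw [← h6]
  exact h.mmse_le s' (ψ := fun _ => x₀) measurable_const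
    (integrable_norm_sq (h.memLp_input.sub (memLp_const x₀)))

/-- Fatou applied to the posterior variance gives lower semicontinuity; applied to ‖estimate‖²,
whose mean is 1 - mmse, it gives upper semicontinuity. No moment beyond the second is needed. -/
lemma continuous_mmse (h : IsSignalLaw P) : Continuous (mmse P) := by
  have := h.prob
  rw [continuous_iff_seqContinuous]
  intro u s hu
  have hc : ∀ p : ℂ × ℂ, Continuous fun s : ℝ => (s, output s p) := fun p => by
    unfold output; fun_prop
  have he : ∀ p : ℂ × ℂ, Continuous fun s : ℝ => ‖estimate P s (output s p)‖ ^ 2 := fun p => by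
    have h1 := (h.continuous_estimate.comp (hc p)).norm.pow 2
    exact h1
  have hq : ∀ p : ℂ × ℂ, Continuous fun s : ℝ => postPower P s (output s p) := fun p => by
    have h1 := h.continuous_postPower.comp (hc p)
    exact h1
  have hi : ∀ s, Integrable (fun p => ‖estimate P s (output s p)‖ ^ 2) (P.prod stdCN) :=
    fun s => integrable_norm_sq (h.memLp_estimate s)
  have hv : ∀ s, Integrable (fun p => postPower P s (output s p)
      - ‖estimate P s (output s p)‖ ^ 2) (P.prod stdCN) :=
    fun s => (h.integrable_postPower s).1.sub (hi s)
  have hve : ∀ s, ∫ p, (postPower P s (output s p) - ‖estimate P s (output s p)‖ ^ 2)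
      ∂(P.prod stdCN) = mmse P s := by
    intro s
    rw [integral_sub (h.integrable_postPower s).1 (hi s), (h.integrable_postPower s).2, h.mmse_eq]
  rw [tendsto_order]
  constructor
  · intro c hlt
    rw [← hve] at hlt
    have hl : ∀ p : ℂ × ℂ, Tendsto (fun n => postPower P (u n) (output (u n) p)
        - ‖estimate P (u n) (output (u n) p)‖ ^ 2) atTop
        (𝓝 (postPower P s (output s p) - ‖estimate P s (output s p)‖ ^ 2)) :=
      fun p => (((hq p).sub (he p)).tendsto s).comp hu
    have := eventually_lt_integral (fun n => hv (u n)) (hv s)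
      (fun n p => sub_nonneg.2 (h.norm_sq_estimate_le (u n) _)) hl hlt
    simpa only [hve, Function.comp_apply] using this
  · intro c hlt
    rw [h.mmse_eq] at hlt
    have hl : ∀ p : ℂ × ℂ, Tendsto (fun n => ‖estimate P (u n) (output (u n) p)‖ ^ 2) atTop
        (𝓝 (‖estimate P s (output s p)‖ ^ 2)) := fun p => ((he p).tendsto s).comp hu
    have := eventually_lt_integral (fun n => hi (u n)) (hi s) (fun n p => sq_nonneg _) hl (show 1 - c < _ by linarith)
    filter_upwards [this] with n hn
    simp only [Function.comp]
    rw [h.mmse_eq]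
    linarith

/-- The weaker channel is a degraded version of the stronger one: scaling the output by a = s/s' and
adding independent noise of amplitude b = √(1 - a²) reproduces it, by stability of the Gaussian law.
For each value of the added noise, the degraded estimate is one more estimator for the stronger
channel. -/
lemma mmse_antitone (h : IsSignalLaw P) {s s' : ℝ} (hs : 0 ≤ s) (hss : s ≤ s') :
    mmse P s' ≤ mmse P s := by
  have := h.prob
  rcases hss.eq_or_lt with rfl | hlt
  · exact le_rfl
  have hs' : 0 < s' := hs.trans_lt hlt
  set a := s / s' with ha
  have ha0 : 0 ≤ a := by positivity
  have ha1 : a ≤ 1 := (div_le_one hs').2 hss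
  set b := √(1 - a ^ 2) with hb
  have hab : a ^ 2 + b ^ 2 = 1 := by
    rw [hb, Real.sq_sqrt (by nlinarith)]
    ring
  have hmp : MeasurePreserving (fun q : (ℂ × ℂ) × ℂ => (q.1.1, (a : ℂ) * q.1.2 + (b : ℂ) * q.2))
      ((P.prod stdCN).prod stdCN) (P.prod stdCN) := by
    have h1 : MeasurePreserving (fun p : ℂ × ℂ => (a : ℂ) * p.1 + (b : ℂ) * p.2)
        (stdCN.prod stdCN) stdCN := ⟨by fun_prop, map_stdCN_prod a b hab⟩
    exact ((MeasurePreserving.id P).prod h1).comp (measurePreserving_prodAssoc P stdCN stdCN)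
  have hsa : (s : ℂ) = a * s' := by
    have : (s' : ℂ) ≠ 0 := by exact_mod_cast hs'.ne'
    rw [ha]
    push_cast
    field_simp
  have hcomp : ∀ q : (ℂ × ℂ) × ℂ, output s (q.1.1, (a : ℂ) * q.1.2 + (b : ℂ) * q.2)
      = (a : ℂ) * output s' q.1 + (b : ℂ) * q.2 := by
    intro q
    simp only [output]
    rw [hsa]
    ring
  have hi : Integrable (fun p => ‖p.1 - estimate P s (output s p)‖ ^ 2) (P.prod stdCN) :=
    integrable_norm_sq (h.memLp_input.sub (h.memLp_estimate s))
  have hi2 := hmp.integrable_comp_of_integrable hi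
  have hmeas : Measurable fun p : ℂ × ℂ => ‖p.1 - estimate P s (output s p)‖ ^ 2 := by
    have := (h.continuous_estimate_right s).measurable.comp (measurable_output s)
    exact ((measurable_fst.sub this).norm).pow_const 2
  have h2 : mmse P s = ∫ q, ‖q.1.1 - estimate P s ((a : ℂ) * output s' q.1 + (b : ℂ) * q.2)‖ ^ 2
      ∂((P.prod stdCN).prod stdCN) := by
    have h1 := integral_map (μ := (P.prod stdCN).prod stdCN) hmp.measurable.aemeasurable
      hmeas.aestronglyMeasurable
    rw [hmp.map_eq] at h1
    rw [mmse, h1]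
    simp only [hcomp]
  have hi3 : Integrable (fun q : (ℂ × ℂ) × ℂ =>
      ‖q.1.1 - estimate P s ((a : ℂ) * output s' q.1 + (b : ℂ) * q.2)‖ ^ 2)
      ((P.prod stdCN).prod stdCN) := by
    simpa only [Function.comp_def, hcomp] using hi2
  rw [h2, integral_prod_symm _ hi3]
  have h3 : mmse P s' = ∫ _, mmse P s' ∂stdCN := by simp
  rw [h3]
  refine integral_mono_ae (integrable_const _) hi3.integral_prod_right ?_
  filter_upwards [hi3.prod_left_ae] with z hz
  exact h.mmse_le s' (ψ := fun y => estimate P s ((a : ℂ) * y + (b : ℂ) * z))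
    ((h.continuous_estimate_right s).measurable.comp (by fun_prop)) hz

end IsSignalLaw

/-! ### Mutual information and its derivative -/

/-- The mutual information of the channel with amplitude `s`, as a difference of entropies. -/
def gaussianInfo (P : Measure ℂ) (s : ℝ) : ℝ :=
  ∫ p, (-‖p.2‖ ^ 2 - Real.log (evidence P s (output s p))) ∂(P.prod stdCN)

namespace IsSignalLaw

lemma integrable_likelihood_mul_norm_sub_sq (h : IsSignalLaw P) (s : ℝ) (y c : ℂ) (b : ℝ) :
    Integrable (fun x => likelihood s x y * ‖c - b * x‖ ^ 2) P := by
  have := h.prob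
  have h1 : MemLp (fun x : ℂ => c - b * x) 2 P := (memLp_const c).sub (h.memLp_id.const_mul _)
  refine (integrable_norm_sq h1).bdd_mul (c := 1)
    (measurable_likelihood_left s y).aestronglyMeasurable
    (Eventually.of_forall fun x => ?_)
  rw [Real.norm_of_nonneg (likelihood_pos _ _ _).le]
  exact likelihood_le_one _ _ _

/-- The Gibbs variational inequality for the log-evidence. -/
lemma le_log_evidence (h : IsSignalLaw P) (s s' : ℝ) (y y' : ℂ) :
    (evidence P s y)⁻¹ * ∫ x, likelihood s x y * (‖y - s * x‖ ^ 2 - ‖y' - s' * x‖ ^ 2) ∂P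
      ≤ Real.log (evidence P s' y') - Real.log (evidence P s y) := by
  have := h.prob
  have hg := evidence_pos (P := P) s y
  set D : ℂ → ℝ := fun x => ‖y - s * x‖ ^ 2 - ‖y' - s' * x‖ ^ 2 with hD
  set d := (evidence P s y)⁻¹ * ∫ x, likelihood s x y * D x ∂P with hd
  have hI : Integrable (fun x => likelihood s x y * D x) P := by
    have := (h.integrable_likelihood_mul_norm_sub_sq s y y s).sub
      (h.integrable_likelihood_mul_norm_sub_sq s y y' s')
    refine this.congr (Eventually.of_forall fun x => ?_)
    simp only [hD, Pi.sub_apply]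
    ring
  -- The tangent bound 1 + (D - d) ≤ exp(D - d) at the posterior mean d of D; integrating it gives
  -- Jensen's inequality.
  have h1 : ∀ x, Real.exp d * ((1 - d) * likelihood s x y + likelihood s x y * D x)
      ≤ likelihood s' x y' := by
    intro x
    have h2 : likelihood s' x y' = likelihood s x y * (Real.exp d * Real.exp (D x - d)) := by
      rw [likelihood, likelihood, ← Real.exp_add, ← Real.exp_add]
      congr 1
      simp only [hD]
      ring
    have h3 := Real.add_one_le_exp (D x - d)
    have h4 : 0 < likelihood s x y * Real.exp d := mul_pos (likelihood_pos _ _ _) (Real.exp_pos _)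
    rw [h2]
    nlinarith [mul_le_mul_of_nonneg_left h3 h4.le]
  have hw := (integrable_likelihood (P := P) s y).const_mul (1 - d)
  have h5 := integral_mono ((hw.add hI).const_mul (Real.exp d))
    (integrable_likelihood (P := P) s' y') h1
  have h6 : ∫ x, likelihood s x y * D x ∂P = evidence P s y * d := by
    rw [hd]
    field_simp
  have h7 : ∫ x, Real.exp d * ((1 - d) * likelihood s x y + likelihood s x y * D x) ∂P
      = Real.exp d * evidence P s y := by
    rw [integral_const_mul, integral_add hw hI, integral_const_mul, h6]
    change Real.exp d * ((1 - d) * evidence P s y + _) = _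
    ring
  have h8 : Real.exp d * evidence P s y ≤ evidence P s' y' := by
    rw [← h7]
    exact h5
  have h9 := Real.log_le_log (by positivity) h8
  rw [Real.log_mul (Real.exp_pos _).ne' hg.ne', Real.log_exp] at h9
  linarith

lemma integral_norm_sub_sq_le (h : IsSignalLaw P) (s : ℝ) (y : ℂ) :
    ∫ x, ‖y - s * x‖ ^ 2 ∂P ≤ 2 * ‖y‖ ^ 2 + 2 * s ^ 2 := by
  have := h.prob
  have h1 : MemLp (fun x : ℂ => y - s * x) 2 P := (memLp_const y).sub (h.memLp_id.const_mul _)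
  have h2 : ∫ x : ℂ, (2 * ‖y‖ ^ 2 + 2 * s ^ 2 * ‖x‖ ^ 2) ∂P = 2 * ‖y‖ ^ 2 + 2 * s ^ 2 := by
    rw [integral_add (integrable_const _) ((integrable_norm_sq h.memLp_id).const_mul _),
      integral_const_mul (2 * s ^ 2), h.power]
    simp
  rw [← h2]
  refine integral_mono (integrable_norm_sq h1)
    ((integrable_const _).add ((integrable_norm_sq h.memLp_id).const_mul _)) fun x => ?_
  have h3 := norm_sub_le y ((s : ℂ) * x)
  have h4 : ‖(s : ℂ) * x‖ ^ 2 = s ^ 2 * ‖x‖ ^ 2 := by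
    rw [norm_mul, mul_pow, Complex.norm_real, Real.norm_eq_abs, sq_abs]
  simp only
  nlinarith [norm_nonneg (y - s * x), sq_nonneg (‖y‖ - ‖(s : ℂ) * x‖), norm_nonneg y,
    norm_nonneg ((s : ℂ) * x)]

/-- The evidence is at most 1, and the Gibbs inequality compared with amplitude 0, where the
evidence is 1, bounds its logarithm below by minus a quadratic in the output. -/
lemma integrable_log_evidence (h : IsSignalLaw P) (s : ℝ) :
    Integrable (fun p => Real.log (evidence P s (output s p))) (P.prod stdCN) := by
  have := h.prob
  refine Integrable.mono' (g := fun p => 2 * ‖output s p‖ ^ 2 + 2 * s ^ 2)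
    (((integrable_norm_sq (h.memLp_output s)).const_mul 2).add (integrable_const _))
    ((measurable_evidence s).comp (measurable_output s)).log.aestronglyMeasurable
    (Eventually.of_forall fun p => ?_)
  have h1 := h.le_log_evidence 0 s 0 (output s p)
  have h2 : ∀ x, likelihood 0 x 0 = 1 := by simp [likelihood]
  have h3 : evidence P 0 0 = 1 := by simp [evidence, h2]
  have h4 := Real.log_nonpos (evidence_pos (P := P) s (output s p)).le (evidence_le_one _ _)
  simp only [h2, h3] at h1
  have h5 := h.integral_norm_sub_sq_le s (output s p)
  rw [Real.norm_of_nonpos h4]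
  have h6 : ∫ x : ℂ, (1 : ℝ) * (‖(0 : ℂ) - ((0 : ℝ) : ℂ) * x‖ ^ 2 - ‖output s p - s * x‖ ^ 2) ∂P
      = -∫ x, ‖output s p - s * x‖ ^ 2 ∂P := by
    rw [← integral_neg]
    simp
  rw [h6] at h1
  simp at h1
  linarith

/-- Substituting z = y - s x and using orthogonality gives s - s E‖estimate‖², so no Gaussian
integration by parts is required. -/
lemma integral_inner_noise_estimate (h : IsSignalLaw P) (s : ℝ) :
    ∫ p, (inner ℝ p.2 (estimate P s (output s p)) : ℝ) ∂(P.prod stdCN) = s * mmse P s := by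
  have := h.prob
  have h1 := h.integral_inner_estimate s (ψ := fun y => y) measurable_id (h.memLp_output s)
  have h2 := h.integral_inner_estimate s (h.continuous_estimate_right s).measurable
    (h.memLp_estimate s)
  simp only [real_inner_self_eq_norm_sq] at h2
  have h3 : ∀ p : ℂ × ℂ, (inner ℝ p.2 (estimate P s (output s p)) : ℝ)
      = inner ℝ (output s p) (estimate P s (output s p))
        - s * inner ℝ (estimate P s (output s p)) p.1 := by
    intro p
    rw [real_inner_comm p.1, ← real_inner_smul_left, ← inner_sub_left, Complex.real_smul, output]
    congr 1
    ring
  have h4 : ∀ p : ℂ × ℂ, (inner ℝ (output s p) p.1 : ℝ)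
      = s * ‖p.1‖ ^ 2 + inner ℝ p.2 p.1 := by
    intro p
    rw [output, inner_add_left, ← Complex.real_smul, real_inner_smul_left,
      real_inner_self_eq_norm_sq]
  simp_rw [h3]
  rw [integral_sub (integrable_inner_of_memLp (h.memLp_output s) (h.memLp_estimate s))
    ((integrable_inner_of_memLp (h.memLp_estimate s) h.memLp_input).const_mul s), h1,
    integral_const_mul, ← h2]
  simp_rw [h4]
  rw [integral_add ((integrable_norm_sq h.memLp_input).const_mul s)
    (integrable_inner_of_memLp h.memLp_noise h.memLp_input), integral_const_mul,
    h.integral_norm_sq_input, h.integral_inner_noise_input, h.mmse_eq]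
  ring

/-- The posterior mean of the exponent increment along a change of amplitude at fixed noise. -/
lemma posterior_increment (h : IsSignalLaw P) (s s' : ℝ) (p : ℂ × ℂ) :
    (evidence P s (output s p))⁻¹ * ∫ x, likelihood s x (output s p)
      * (‖output s p - s * x‖ ^ 2 - ‖output s' p - s' * x‖ ^ 2) ∂P
    = -(2 * (s' - s)) * (inner ℝ p.2 p.1 - inner ℝ p.2 (estimate P s (output s p)))
      - (s' ^ 2 - s ^ 2) * (‖p.1 - estimate P s (output s p)‖ ^ 2
        + (postPower P s (output s p) - ‖estimate P s (output s p)‖ ^ 2)) := by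
  have := h.prob
  set y := output s p with hy
  set c := estimate P s y with hc
  have hg := (evidence_pos (P := P) s y).ne'
  -- Opaque names keep `simp` from expanding the real coefficients inside complex casts. The vector
  -- `k` built from them collects the part of the exponent increment that is linear in x.
  obtain ⟨a, ha⟩ : ∃ a, a = 2 * (s' - s) := ⟨_, rfl⟩
  obtain ⟨b, hb⟩ : ∃ b, b = 2 * (s' ^ 2 - s ^ 2) := ⟨_, rfl⟩
  set k : ℂ := (a : ℂ) * p.2 + (b : ℂ) * p.1 with hk
  have h1 : ∀ x, likelihood s x y * (‖y - s * x‖ ^ 2 - ‖output s' p - s' * x‖ ^ 2)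
      = ((-(2 * (s' - s)) * inner ℝ p.2 p.1 - (s' ^ 2 - s ^ 2) * ‖p.1‖ ^ 2) * likelihood s x y
        + ((starRingEnd ℂ) k * ((likelihood s x y : ℂ) * x)).re)
        - (s' ^ 2 - s ^ 2) * (likelihood s x y * ‖x‖ ^ 2) := by
    intro x
    have h2 : ((starRingEnd ℂ) k * ((likelihood s x y : ℂ) * x)).re
        = likelihood s x y * ((starRingEnd ℂ) k * x).re := by
      rw [← Complex.re_ofReal_mul]; congr 1; ring
    rw [h2]
    simp only [hy, hk, output, ← Complex.normSq_eq_norm_sq, Complex.normSq_apply, Complex.inner]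
    simp
    rw [ha, hb]
    ring
  have hI := (h.integrable_likelihood_mul s y).const_mul ((starRingEnd ℂ) k)
  have hI2 : Integrable (fun x => ((starRingEnd ℂ) k * ((likelihood s x y : ℂ) * x)).re) P := hI.re
  have hI3 := (h.integrable_likelihood_mul_sq s y).const_mul (s' ^ 2 - s ^ 2)
  have hI4 := (integrable_likelihood (P := P) s y).const_mul
    (-(2 * (s' - s)) * inner ℝ p.2 p.1 - (s' ^ 2 - s ^ 2) * ‖p.1‖ ^ 2)
  have h2 : ∫ x, ((starRingEnd ℂ) k * ((likelihood s x y : ℂ) * x)).re ∂P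
      = evidence P s y * ((starRingEnd ℂ) k * c).re := by
    have h3 := integral_re hI
    refine h3.trans ?_
    have h4 : ∫ x, (likelihood s x y : ℂ) * x ∂P = (evidence P s y : ℂ) * c := by
      have : (evidence P s y : ℂ) ≠ 0 := by exact_mod_cast hg
      rw [hc, estimate, postMean]
      push_cast
      field_simp
    rw [integral_const_mul, h4]
    change ((starRingEnd ℂ) k * ((evidence P s y : ℂ) * c)).re = _
    rw [← Complex.re_ofReal_mul]
    congr 1
    ring
  have h6 : ∫ x, likelihood s x y * ‖x‖ ^ 2 ∂P = evidence P s y * postPower P s y := by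
    rw [postPower]
    field_simp
  simp_rw [h1]
  have hI5 := hI4.add hI2
  rw [integral_sub (show Integrable (fun x => (-(2 * (s' - s)) * inner ℝ p.2 p.1
    - (s' ^ 2 - s ^ 2) * ‖p.1‖ ^ 2) * likelihood s x y
    + ((starRingEnd ℂ) k * ((likelihood s x y : ℂ) * x)).re) P from hI5) hI3, integral_add hI4 hI2, integral_const_mul, integral_const_mul,
    h2, h6]
  change (evidence P s y)⁻¹ * (_ * evidence P s y + _ - _) = _
  have h7 : ((starRingEnd ℂ) k * c).re = 2 * (s' - s) * inner ℝ p.2 c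
      + (s' ^ 2 - s ^ 2) * (‖p.1‖ ^ 2 - ‖p.1 - c‖ ^ 2 + ‖c‖ ^ 2) := by
    simp only [hk, ← Complex.normSq_eq_norm_sq, Complex.normSq_apply, Complex.inner]
    simp
    rw [ha, hb]
    ring
  rw [h7]
  field_simp
  ring

lemma integrable_gaussianInfo (h : IsSignalLaw P) (s : ℝ) :
    Integrable (fun p : ℂ × ℂ => -‖p.2‖ ^ 2 - Real.log (evidence P s (output s p)))
      (P.prod stdCN) :=
  (integrable_norm_sq h.memLp_noise).neg.sub (h.integrable_log_evidence s)

/-- One-sided bound on the increments of the mutual information, for arbitrary amplitudes. -/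
lemma gaussianInfo_sub_le (h : IsSignalLaw P) (s s' : ℝ) :
    gaussianInfo P s' - gaussianInfo P s ≤ 2 * (s' - s) * s' * mmse P s := by
  have := h.prob
  have hzx := integrable_inner_of_memLp h.memLp_noise h.memLp_input
  have hze := integrable_inner_of_memLp h.memLp_noise (h.memLp_estimate s)
  have hd : Integrable (fun p => ‖p.1 - estimate P s (output s p)‖ ^ 2) (P.prod stdCN) :=
    integrable_norm_sq (h.memLp_input.sub (h.memLp_estimate s))
  have he := integrable_norm_sq (h.memLp_estimate s)
  obtain ⟨hq, hq1⟩ := h.integrable_postPower s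
  have hqe : Integrable (fun p => postPower P s (output s p)
      - ‖estimate P s (output s p)‖ ^ 2) (P.prod stdCN) := hq.sub he
  have hA : Integrable (fun p : ℂ × ℂ => -(2 * (s' - s))
      * ((inner ℝ p.2 p.1 : ℝ) - inner ℝ p.2 (estimate P s (output s p)))) (P.prod stdCN) :=
    (hzx.sub hze).const_mul _
  have hB : Integrable (fun p => (s' ^ 2 - s ^ 2) * (‖p.1 - estimate P s (output s p)‖ ^ 2
      + (postPower P s (output s p) - ‖estimate P s (output s p)‖ ^ 2))) (P.prod stdCN) :=
    (hd.add hqe).const_mul _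
  -- The true squared error and the posterior variance both have mean `mmse P s`, so the quadratic
  -- term counts twice; with the noise term this leaves the factor s' instead of s.
  have h1 := integral_mono (hA.sub hB)
    ((h.integrable_log_evidence s').sub (h.integrable_log_evidence s)) (fun p => by
      simp only [Pi.sub_apply]
      rw [← h.posterior_increment s s' p]
      exact h.le_log_evidence s s' (output s p) (output s' p))
  rw [integral_sub' hA hB, integral_const_mul, integral_const_mul, integral_sub hzx hze,
    integral_add hd hqe, integral_sub hq he, hq1, h.integral_inner_noise_input,
    h.integral_inner_noise_estimate,
    integral_sub' (h.integrable_log_evidence s') (h.integrable_log_evidence s)] at h1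
  have h2 : gaussianInfo P s' - gaussianInfo P s
      = ∫ p, Real.log (evidence P s (output s p)) ∂(P.prod stdCN)
        - ∫ p, Real.log (evidence P s' (output s' p)) ∂(P.prod stdCN) := by
    have hn : Integrable (fun p : ℂ × ℂ => -‖p.2‖ ^ 2) (P.prod stdCN) :=
      (integrable_norm_sq h.memLp_noise).neg
    rw [gaussianInfo, gaussianInfo, integral_sub hn (h.integrable_log_evidence s),
      integral_sub hn (h.integrable_log_evidence s')]
    ring
  have h3 : ∫ p, ‖p.1 - estimate P s (output s p)‖ ^ 2 ∂(P.prod stdCN) = mmse P s := rfl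
  rw [h3, ← h.mmse_eq] at h1
  rw [h2]
  linarith

lemma hasDerivAt_gaussianInfo (h : IsSignalLaw P) (s : ℝ) :
    HasDerivAt (gaussianInfo P) (2 * s * mmse P s) s := by
  rw [hasDerivAt_iff_tendsto_slope]
  have hb : Tendsto (fun t => |2 * s * (mmse P t - mmse P s)| + |2 * (t - s) * mmse P s|)
      (𝓝[≠] s) (𝓝 0) := by
    have hc : Continuous fun t => |2 * s * (mmse P t - mmse P s)| + |2 * (t - s) * mmse P s| := by
      have := h.continuous_mmse
      fun_prop
    have := (hc.tendsto s).mono_left (nhdsWithin_le_nhds (s := {s}ᶜ))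
    simpa using this
  refine tendsto_sub_nhds_zero_iff.1 ?_
  refine squeeze_zero_norm' ?_ hb
  filter_upwards [self_mem_nhdsWithin] with t ht
  have hts : t - s ≠ 0 := sub_ne_zero.2 ht
  -- Both orders of the amplitudes trap the slope between 2 t mmse(s) and 2 s mmse(t); dividing by t
  -- - s fixes which is the upper bound.
  have h1 := h.gaussianInfo_sub_le s t
  have h2 := h.gaussianInfo_sub_le t s
  have h3 : slope (gaussianInfo P) s t * (t - s) = gaussianInfo P t - gaussianInfo P s := by
    rw [slope_def_field]
    field_simp
  set σ := slope (gaussianInfo P) s t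
  have e1 := le_abs_self (2 * s * (mmse P t - mmse P s))
  have e2 := neg_abs_le (2 * s * (mmse P t - mmse P s))
  have e3 := le_abs_self (2 * (t - s) * mmse P s)
  have e4 := neg_abs_le (2 * (t - s) * mmse P s)
  have p1 := abs_nonneg (2 * s * (mmse P t - mmse P s))
  have p2 := abs_nonneg (2 * (t - s) * mmse P s)
  rw [Real.norm_eq_abs, abs_le]
  rcases lt_or_gt_of_ne hts with hneg | hpos
  · have u1 : 2 * t * mmse P s ≤ σ := by
      by_contra hcon
      nlinarith [mul_lt_mul_of_neg_right (not_le.1 hcon) hneg]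
    have u2 : σ ≤ 2 * s * mmse P t := by
      by_contra hcon
      nlinarith [mul_lt_mul_of_neg_right (not_le.1 hcon) hneg]
    constructor <;> linarith
  · have u1 : σ ≤ 2 * t * mmse P s := by
      by_contra hcon
      nlinarith [mul_lt_mul_of_pos_right (not_le.1 hcon) hpos]
    have u2 : 2 * s * mmse P t ≤ σ := by
      by_contra hcon
      nlinarith [mul_lt_mul_of_pos_right (not_le.1 hcon) hpos]
    constructor <;> linarith

lemma gaussianInfo_zero (h : IsSignalLaw P) : gaussianInfo P 0 = 0 := by
  have := h.prob
  refine integral_eq_zero_of_ae (Eventually.of_forall fun p => ?_)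
  simp [evidence, likelihood, output]

/-- The I-MMSE relation. -/
lemma integral_mmse (h : IsSignalLaw P) {ρ : ℝ} (hρ : 0 ≤ ρ) :
    ∫ r in (0 : ℝ)..ρ, mmse P (√r) = gaussianInfo P (√ρ) := by
  have hcont : Continuous (gaussianInfo P) :=
    continuous_iff_continuousAt.2 fun s => (h.hasDerivAt_gaussianInfo s).continuousAt
  -- This form asks for derivatives only in the open interval, since √ is not differentiable at 0.
  have h1 := intervalIntegral.integral_eq_sub_of_hasDerivAt_of_le hρ
    (f := fun r => gaussianInfo P (√r)) (f' := fun r => mmse P (√r))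
    (hcont.comp Real.continuous_sqrt).continuousOn (fun r hr => ?_)
    ((h.continuous_mmse.comp Real.continuous_sqrt).intervalIntegrable _ _)
  · simpa [h.gaussianInfo_zero] using h1
  · have hr0 : 0 < √r := Real.sqrt_pos.2 hr.1
    have := (h.hasDerivAt_gaussianInfo (√r)).comp r (Real.hasDerivAt_sqrt hr.1.ne')
    refine this.congr_deriv ?_
    field_simp

end IsSignalLaw

/-! ### The mutual information of the channel -/

lemma map_output_eq_withDensity [IsProbabilityMeasure P] (s : ℝ) :
    (P.prod stdCN).map (output s) = (volume : Measure ℂ).withDensity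
      (fun y => ENNReal.ofReal (Real.pi⁻¹ * evidence P s y)) := by
  have hm : Measurable (fun p : ℂ × ℂ => (p.1, output s p)) := by fun_prop
  have hd : Measurable fun y => ENNReal.ofReal (Real.pi⁻¹ * evidence P s y) :=
    ((measurable_evidence s).const_mul _).ennreal_ofReal
  have h1 : (P.prod stdCN).map (output s)
      = ((P.prod stdCN).map (fun p => (p.1, output s p))).map Prod.snd := by
    rw [Measure.map_map measurable_snd hm]
    rfl
  rw [h1, map_input_output]
  refine Measure.ext_of_lintegral _ fun f hf => ?_
  rw [lintegral_map hf measurable_snd, lintegral_withDensity_eq_lintegral_mul _ (by fun_prop)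
    (show Measurable fun p : ℂ × ℂ => f p.2 from hf.comp measurable_snd),
    lintegral_withDensity_eq_lintegral_mul _ hd hf, lintegral_prod_symm _ (by fun_prop)]
  refine lintegral_congr fun y => ?_
  simp only [Pi.mul_apply]
  rw [lintegral_mul_const _ (by fun_prop), ← ofReal_integral_eq_lintegral_ofReal
    ((integrable_likelihood s y).const_mul _)
    (Eventually.of_forall fun x => mul_nonneg (by positivity) (likelihood_pos _ _ _).le),
    integral_const_mul]
  rfl

lemma map_input_output_eq_withDensity [IsProbabilityMeasure P] (s : ℝ) :
    (P.prod stdCN).map (fun p => (p.1, output s p))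
      = (((P.prod stdCN).map fun p => p.1).prod ((P.prod stdCN).map (output s))).withDensity
        (fun p => ENNReal.ofReal (likelihood s p.1 p.2 / evidence P s p.2)) := by
  have hd : Measurable fun y => ENNReal.ofReal (Real.pi⁻¹ * evidence P s y) :=
    ((measurable_evidence s).const_mul _).ennreal_ofReal
  have hr : Measurable fun p : ℂ × ℂ => ENNReal.ofReal (likelihood s p.1 p.2 / evidence P s p.2) :=
    ((measurable_likelihood s).div ((measurable_evidence s).comp measurable_snd)).ennreal_ofReal
  have h1 : ((P.prod stdCN).map fun p => p.1) = P := measurePreserving_fst.map_eq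
  rw [h1, map_output_eq_withDensity, prod_withDensity_right hd,
    ← withDensity_mul _ (show Measurable fun p : ℂ × ℂ =>
      ENNReal.ofReal (Real.pi⁻¹ * evidence P s p.2) from hd.comp measurable_snd) hr, map_input_output]
  congr 1
  ext p
  have hg := evidence_pos (P := P) s p.2
  simp only [Pi.mul_apply]
  rw [← ENNReal.ofReal_mul (by positivity)]
  congr 1
  field_simp

/-- The mutual information of the scalar Gaussian channel. -/
lemma IsSignalLaw.channelInfo_eq (h : IsSignalLaw P) (ρ : ℝ) :
    channelInfo P ρ ≠ ∞ ∧ (channelInfo P ρ).toReal = gaussianInfo P (√ρ) := by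
  have := h.prob
  set s := √ρ with hs
  have hm : Measurable (fun p : ℂ × ℂ => (p.1, output s p)) := by fun_prop
  set J := (P.prod stdCN).map (fun p => (p.1, output s p)) with hJ
  set R := ((P.prod stdCN).map fun p => p.1).prod ((P.prod stdCN).map (output s)) with hR
  have hch : channelInfo P ρ = InformationTheory.klDiv J R := rfl
  have i1 : IsProbabilityMeasure J := Measure.isProbabilityMeasure_map hm.aemeasurable
  have i2 : IsProbabilityMeasure ((P.prod stdCN).map fun p => p.1) :=
    Measure.isProbabilityMeasure_map measurable_fst.aemeasurable
  have i3 : IsProbabilityMeasure ((P.prod stdCN).map (output s)) :=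
    Measure.isProbabilityMeasure_map (measurable_output s).aemeasurable
  have hd : Measurable fun p : ℂ × ℂ => likelihood s p.1 p.2 / evidence P s p.2 :=
    (measurable_likelihood s).div ((measurable_evidence s).comp measurable_snd)
  have hJR : J = R.withDensity
      (fun p => ENNReal.ofReal (likelihood s p.1 p.2 / evidence P s p.2)) :=
    map_input_output_eq_withDensity s
  have hac : J ≪ R := by
    rw [hJR]
    exact withDensity_absolutelyContinuous _ _
  have hl : llr J R =ᵐ[J] fun p => -‖p.2 - s * p.1‖ ^ 2 - Real.log (evidence P s p.2) := by
    have h1 := Measure.rnDeriv_withDensity R hd.ennreal_ofReal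
    rw [← hJR] at h1
    filter_upwards [hac.ae_le h1] with p hp
    have hg := evidence_pos (P := P) s p.2
    have hw := likelihood_pos s p.1 p.2
    rw [llr, hp, ENNReal.toReal_ofReal (by positivity), Real.log_div hw.ne' hg.ne', likelihood,
      Real.log_exp]
  have hmeas : Measurable fun p : ℂ × ℂ =>
      -‖p.2 - s * p.1‖ ^ 2 - Real.log (evidence P s p.2) := by
    have : Measurable fun p : ℂ × ℂ => evidence P s p.2 :=
      (measurable_evidence s).comp measurable_snd
    exact Measurable.sub (by fun_prop) this.log
  -- On the channel y - s x is the noise, which turns the log-likelihood ratio into the integrand of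
  -- `gaussianInfo`.
  have hcomp : ∀ p : ℂ × ℂ, -‖output s p - s * p.1‖ ^ 2 - Real.log (evidence P s (output s p))
      = -‖p.2‖ ^ 2 - Real.log (evidence P s (output s p)) := by
    intro p
    simp [output]
  have hint : Integrable (llr J R) J := by
    rw [integrable_congr hl, hJ, integrable_map_measure hmeas.aestronglyMeasurable hm.aemeasurable]
    simp only [Function.comp_def, hcomp]
    exact h.integrable_gaussianInfo s
  rw [hch]
  refine ⟨InformationTheory.klDiv_ne_top hac hint, ?_⟩
  rw [InformationTheory.toReal_klDiv_of_measure_eq hac (by simp), integral_congr_ae hl, hJ,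
    integral_map hm.aemeasurable hmeas.aestronglyMeasurable]
  simp only [hcomp]
  rfl

/-! ### The vector MMSE decouples -/

lemma measurable_observation (n : ℕ) (ρ : ℝ) : Measurable (observation n ρ) := by
  unfold observation
  fun_prop

instance isProbabilityMeasure_signalNoise [IsProbabilityMeasure P] (n : ℕ) :
    IsProbabilityMeasure (signalNoise P n) := by
  unfold signalNoise
  infer_instance

/-- Separate coordinate `i` of the signal and the noise from the other coordinates. -/
def splitCoord {n : ℕ} (i : Fin (n + 1)) (p : (Fin (n + 1) → ℂ) × (Fin (n + 1) → ℂ)) :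
    (ℂ × ℂ) × ((Fin n → ℂ) × (Fin n → ℂ)) :=
  ((p.1 i, p.2 i), (fun j => p.1 (i.succAbove j), fun j => p.2 (i.succAbove j)))

lemma measurePreserving_splitCoord [IsProbabilityMeasure P] {n : ℕ} (i : Fin (n + 1)) :
    MeasurePreserving (splitCoord i) (signalNoise P (n + 1))
      ((P.prod stdCN).prod (signalNoise P n)) := by
  have h1 := (measurePreserving_piFinSuccAbove (fun _ : Fin (n + 1) => P) i).prod
    (measurePreserving_piFinSuccAbove (fun _ : Fin (n + 1) => stdCN) i)
  have h2 : MeasurePreserving (fun q : (ℂ × (Fin n → ℂ)) × (ℂ × (Fin n → ℂ)) =>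
      ((q.1.1, q.2.1), (q.1.2, q.2.2)))
      ((P.prod (Measure.pi fun _ => P)).prod (stdCN.prod (Measure.pi fun _ => stdCN)))
      ((P.prod stdCN).prod (signalNoise P n)) := by
    -- Only a reordering of the four independent factors, by Tonelli.
    refine ⟨by fun_prop, Measure.ext_of_lintegral _ fun f hf => ?_⟩
    rw [lintegral_map hf (by fun_prop), lintegral_prod _ (by fun_prop),
      lintegral_prod _ (by fun_prop), signalNoise, lintegral_prod _ hf.aemeasurable,
      lintegral_prod _ (by fun_prop)]
    refine lintegral_congr fun x => ?_
    have e1 : ∀ xr : Fin n → ℂ, ∫⁻ q : ℂ × (Fin n → ℂ), f ((x, q.1), (xr, q.2))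
        ∂(stdCN.prod (Measure.pi fun _ => stdCN))
        = ∫⁻ z, ∫⁻ zr, f ((x, z), (xr, zr)) ∂(Measure.pi fun _ => stdCN) ∂stdCN := fun xr =>
      lintegral_prod _ (by fun_prop)
    have e2 : ∀ z : ℂ, ∫⁻ r, f ((x, z), r)
        ∂((Measure.pi fun _ : Fin n => P).prod (Measure.pi fun _ : Fin n => stdCN))
        = ∫⁻ xr, ∫⁻ zr, f ((x, z), (xr, zr)) ∂(Measure.pi fun _ => stdCN)
          ∂(Measure.pi fun _ => P) := fun z => lintegral_prod _ (by fun_prop)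
    simp_rw [e1, e2]
    refine lintegral_lintegral_swap (Measurable.aemeasurable ?_)
    exact Measurable.lintegral_prod_right'
      (f := fun q : ((Fin n → ℂ) × ℂ) × (Fin n → ℂ) => f ((x, q.1.2), (q.1.1, q.2)))
      (by fun_prop)
  exact h2.comp h1

lemma observation_eq_insertNth {n : ℕ} (i : Fin (n + 1)) (ρ : ℝ)
    (p : (Fin (n + 1) → ℂ) × (Fin (n + 1) → ℂ)) :
    observation (n + 1) ρ p = (MeasurableEquiv.piFinSuccAbove (fun _ => ℂ) i).symm
      (output (√ρ) (splitCoord i p).1, observation n ρ (splitCoord i p).2) := by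
  rw [MeasurableEquiv.eq_symm_apply]
  rfl

namespace IsSignalLaw

/-- The other coordinates of the observation are independent of the pair at `i`. Freezing them turns
any event of the whole observation into an event of the scalar output, to which the scalar tower
property applies. -/
lemma condExp_observation (h : IsSignalLaw P) {n : ℕ} (i : Fin (n + 1)) (ρ : ℝ) :
    (fun p => estimate P (√ρ) (observation (n + 1) ρ p i)) =ᵐ[signalNoise P (n + 1)]
      (signalNoise P (n + 1))[(fun q : (Fin (n + 1) → ℂ) × (Fin (n + 1) → ℂ) => q.1 i) |
        MeasurableSpace.comap (observation (n + 1) ρ) inferInstance] := by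
  have := h.prob
  have hmp := measurePreserving_splitCoord (P := P) i
  have hm : MeasurableSpace.comap (observation (n + 1) ρ) inferInstance
      ≤ (inferInstance : MeasurableSpace ((Fin (n + 1) → ℂ) × (Fin (n + 1) → ℂ))) :=
    (measurable_observation _ _).comap_le
  have hx : Integrable (fun q : (ℂ × ℂ) × ((Fin n → ℂ) × (Fin n → ℂ)) => q.1.1)
      ((P.prod stdCN).prod (signalNoise P n)) :=
    (h.memLp_input.integrable one_le_two).comp_fst _
  have he : Integrable (fun q : (ℂ × ℂ) × ((Fin n → ℂ) × (Fin n → ℂ)) =>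
      estimate P (√ρ) (output (√ρ) q.1)) ((P.prod stdCN).prod (signalNoise P n)) :=
    ((h.memLp_estimate (√ρ)).integrable one_le_two).comp_fst _
  have hX : Integrable (fun p : (Fin (n + 1) → ℂ) × (Fin (n + 1) → ℂ) => p.1 i)
      (signalNoise P (n + 1)) := hmp.integrable_comp_of_integrable hx
  have hE : Integrable (fun p => estimate P (√ρ) (observation (n + 1) ρ p i))
      (signalNoise P (n + 1)) := hmp.integrable_comp_of_integrable he
  refine ae_eq_condExp_of_forall_setIntegral_eq hm hX (fun s _ _ => hE.integrableOn) ?_ ?_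
  · rintro s ⟨B, hB, rfl⟩ -
    have hs : MeasurableSet (observation (n + 1) ρ ⁻¹' B) := measurable_observation _ _ hB
    rw [← sub_eq_zero, ← integral_sub hE.integrableOn hX.integrableOn, ← integral_indicator hs]
    set D : Set ((ℂ × ℂ) × ((Fin n → ℂ) × (Fin n → ℂ))) :=
      {q | (MeasurableEquiv.piFinSuccAbove (fun _ => ℂ) i).symm
        (output (√ρ) q.1, observation n ρ q.2) ∈ B} with hD
    have hDm : MeasurableSet D := by
      have : Measurable fun q : (ℂ × ℂ) × ((Fin n → ℂ) × (Fin n → ℂ)) =>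
          (output (√ρ) q.1, observation n ρ q.2) :=
        ((measurable_output _).comp measurable_fst).prodMk
          ((measurable_observation _ _).comp measurable_snd)
      exact ((MeasurableEquiv.piFinSuccAbove (fun _ => ℂ) i).symm.measurable.comp this) hB
    set G : (ℂ × ℂ) × ((Fin n → ℂ) × (Fin n → ℂ)) → ℂ :=
      D.indicator (fun q => estimate P (√ρ) (output (√ρ) q.1) - q.1.1) with hG
    have hGi : Integrable G ((P.prod stdCN).prod (signalNoise P n)) :=
      (he.sub hx).indicator hDm
    have h1 : ∫ p, (observation (n + 1) ρ ⁻¹' B).indicator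
        (fun p => estimate P (√ρ) (observation (n + 1) ρ p i) - p.1 i) p ∂(signalNoise P (n + 1))
        = ∫ q, G q ∂((P.prod stdCN).prod (signalNoise P n)) := by
      rw [← hmp.map_eq, integral_map hmp.measurable.aemeasurable (by rw [hmp.map_eq]; exact hGi.1)]
      refine integral_congr_ae (Eventually.of_forall fun p => ?_)
      have : observation (n + 1) ρ ⁻¹' B = splitCoord i ⁻¹' D := by
        ext p
        simp only [hD, mem_preimage, mem_ofPred_eq, observation_eq_insertNth i]
      rw [this]
      rfl
    rw [h1, integral_prod_symm _ hGi]
    refine integral_eq_zero_of_ae (Eventually.of_forall fun r => ?_)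
    -- Indicator of the slice of `B` at the frozen coordinates `r`.
    set F : ℂ → ℂ := {y | (MeasurableEquiv.piFinSuccAbove (fun _ => ℂ) i).symm
        (y, observation n ρ r) ∈ B}.indicator (fun _ => 1) with hF
    have hFm : Measurable F := by
      refine measurable_const.indicator ?_
      have : Measurable fun y : ℂ => (y, observation n ρ r) := by fun_prop
      exact ((MeasurableEquiv.piFinSuccAbove (fun _ => ℂ) i).symm.measurable.comp this) hB
    have hi : Integrable (fun p => F (output (√ρ) p) * p.1) (P.prod stdCN) := by
      refine (h.memLp_input.integrable one_le_two).bdd_mul (c := 1)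
        (hFm.comp (measurable_output _)).aestronglyMeasurable (Eventually.of_forall fun p => ?_)
      refine (norm_indicator_le_norm_self _ _).trans ?_
      simp
    obtain ⟨t1, t2⟩ := integral_mul_postMean (P := P) (√ρ) (h := fun x => x) hFm measurable_id hi
    have h2 : ∀ p : ℂ × ℂ, G (p, r) = F (output (√ρ) p) * postMean P (√ρ) (fun x => x)
        (output (√ρ) p) - F (output (√ρ) p) * p.1 := by
      intro p
      rw [← mul_sub]
      by_cases hp : (p, r) ∈ D
      · have hp' : F (output (√ρ) p) = 1 := indicator_of_mem (by exact hp) _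
        rw [hp', hG, indicator_of_mem hp, one_mul]
        rfl
      · have hp' : F (output (√ρ) p) = 0 := indicator_of_notMem (by exact hp) _
        rw [hp', hG, indicator_of_notMem hp, zero_mul]
    simp_rw [h2]
    rw [integral_sub t1 hi, t2]
    simp
  · have h1 : Measurable[MeasurableSpace.comap (observation (n + 1) ρ) inferInstance]
        (fun p => estimate P (√ρ) (observation (n + 1) ρ p i)) := by
      have h2 : Measurable fun y : Fin (n + 1) → ℂ => estimate P (√ρ) (y i) :=
        (h.continuous_estimate_right _).measurable.comp (measurable_pi_apply i)
      exact h2.comp (comap_measurable (observation (n + 1) ρ))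
    exact h1.stronglyMeasurable.aestronglyMeasurable

lemma phiHat_eq (h : IsSignalLaw P) {n : ℕ} (hn : 0 < n) (ρ : ℝ) :
    phiHat P n ρ = mmse P (√ρ) := by
  have := h.prob
  obtain ⟨m, rfl⟩ : ∃ m, n = m + 1 := ⟨n - 1, by omega⟩
  have h1 : ∀ i : Fin (m + 1), ∫ p, ‖p.1 i - ((signalNoise P (m + 1))[(fun q :
      (Fin (m + 1) → ℂ) × (Fin (m + 1) → ℂ) => q.1 i) |
      MeasurableSpace.comap (observation (m + 1) ρ) inferInstance]) p‖ ^ 2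
      ∂(signalNoise P (m + 1)) = mmse P (√ρ) := by
    intro i
    have hmp := measurePreserving_fst.comp (measurePreserving_splitCoord (P := P) i)
    have hmeas : Measurable fun p : ℂ × ℂ => ‖p.1 - estimate P (√ρ) (output (√ρ) p)‖ ^ 2 := by
      have := (h.continuous_estimate_right (√ρ)).measurable.comp (measurable_output (√ρ))
      exact ((measurable_fst.sub this).norm).pow_const 2
    rw [mmse]
    conv_rhs => rw [← hmp.map_eq]
    rw [integral_map hmp.measurable.aemeasurable hmeas.aestronglyMeasurable]
    refine integral_congr_ae ?_
    filter_upwards [h.condExp_observation i ρ] with p hp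
    rw [← hp]
    rfl
  rw [phiHat]
  simp_rw [h1]
  simp
  field_simp

end IsSignalLaw

/-! ### Areas between graphs -/

/-- The boundary graphs carry no area: enlarging the band by ε on either side covers them at cost 2
ε |s|, and ε → 0. This allows a mix of strict and weak inequalities in `S`. -/
lemma volume_eq_of_regionBetween {S : Set (ℝ × ℝ)} {f g : ℝ → ℝ} {s : Set ℝ}
    (hs : MeasurableSet s) (hs' : volume s ≠ ∞) (hf : IntegrableOn f s) (hg : IntegrableOn g s)
    (hfg : ∀ x ∈ s, f x ≤ g x) (hlow : regionBetween f g s ⊆ S)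
    (hup : ∀ p ∈ S, p.1 ∈ s ∧ f p.1 ≤ p.2 ∧ p.2 ≤ g p.1) :
    volume S = ENNReal.ofReal (∫ x in s, (g x - f x)) := by
  have hfin : IsFiniteMeasure (volume.restrict s) := ⟨by simpa using hs'.lt_top⟩
  refine le_antisymm ?_ ?_
  · have hb : ∀ ε : ℝ, 0 < ε →
        volume S ≤ ENNReal.ofReal ((∫ x in s, (g x - f x)) + 2 * ε * volume.real s) := by
      intro ε hε
      have hf' : IntegrableOn (fun x => f x - ε) s := hf.sub (integrable_const _)
      have hg' : IntegrableOn (fun x => g x + ε) s := hg.add (integrable_const _)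
      have h1 : S ⊆ regionBetween (fun x => f x - ε) (fun x => g x + ε) s := fun p hp =>
        ⟨(hup p hp).1, by linarith [(hup p hp).2.1], by linarith [(hup p hp).2.2]⟩
      refine (measure_mono h1).trans (le_of_eq ?_)
      rw [Measure.volume_eq_prod, volume_regionBetween_eq_integral hf' hg' hs
        (fun x hx => by linarith [hfg x hx])]
      congr 1
      have h2 : ∀ x, ((fun x => g x + ε) - fun x => f x - ε) x = (g x - f x) + 2 * ε := fun x => by
        simp only [Pi.sub_apply]
        ring
      simp_rw [h2]
      have hgf : IntegrableOn (fun x => g x - f x) s := hg.sub hf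
      rw [integral_add hgf (integrable_const _)]
      simp
      ring
    have hl : Tendsto (fun ε : ℝ => ENNReal.ofReal ((∫ x in s, (g x - f x))
        + 2 * ε * volume.real s)) (𝓝[>] 0) (𝓝 (ENNReal.ofReal (∫ x in s, (g x - f x)))) := by
      refine ENNReal.tendsto_ofReal ?_
      have hc : Continuous fun ε : ℝ => (∫ x in s, (g x - f x)) + 2 * ε * volume.real s := by
        fun_prop
      have := (hc.tendsto 0).mono_left (nhdsWithin_le_nhds (s := Ioi 0))
      simpa using this
    exact ge_of_tendsto hl (by filter_upwards [self_mem_nhdsWithin] with ε hε using hb ε hε)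
  · refine le_trans (le_of_eq ?_) (measure_mono hlow)
    rw [Measure.volume_eq_prod, volume_regionBetween_eq_integral hf hg hs hfg]
    rfl

/-! ### Parametrization of the transfer function of the linear estimator -/

section Transfer

variable {μ : Measure ℝ} {a : ℝ} {γ φ : ℝ → ℝ}

lemma etaDomain_eq (hγ : ∀ w, 0 < w → γ w = resolventMean μ a w⁻¹) :
    etaDomain γ = resolventMean μ a '' Ioi 0 := by
  ext v
  constructor
  · rintro ⟨w, hw, rfl⟩
    exact ⟨w⁻¹, mem_Ioi.2 (inv_pos.2 hw), (hγ w hw).symm⟩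
  · rintro ⟨t, ht, rfl⟩
    exact ⟨t⁻¹, mem_Ioi.2 (inv_pos.2 ht), by rw [hγ _ (inv_pos.2 ht), inv_inv]⟩

/-- Injectivity of the resolvent forces the chosen preimage of G(t) under γ to be 1/t. -/
lemma eta_resolventMean (h : IsSpectralLaw μ) (ha : 0 < a)
    (hγ : ∀ w, 0 < w → γ w = resolventMean μ a w⁻¹) {t : ℝ} (ht : 0 < t) :
    eta γ (resolventMean μ a t) = etaParam μ a t := by
  have hmem : resolventMean μ a t ∈ γ '' Ioi 0 := by
    have := etaDomain_eq hγ
    rw [etaDomain] at this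
    rw [this]
    exact ⟨t, ht, rfl⟩
  have h1 := Function.invFunOn_eq hmem
  have h2 : 0 < Function.invFunOn γ (Ioi 0) (resolventMean μ a t) := Function.invFunOn_mem hmem
  rw [hγ _ h2] at h1
  have h3 := (h.strictAntiOn_resolventMean ha).injOn (mem_Ioi.2 (inv_pos.2 h2)) ht h1
  rw [eta, h3, etaParam]

lemma stieltjes_eq (ha : 0 < a) (z : ℝ) : stieltjes μ z = a * resolventMean μ a (-(a * z)) := by
  rw [stieltjes, resolventMean, ← integral_const_mul]
  congr 1
  ext x
  have : a * x + -(a * z) = a * (x - z) := by ring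
  rw [this, mul_inv]
  field_simp

lemma mem_image_stieltjes (ha : 0 < a) (v : ℝ) :
    a * v ∈ stieltjes μ '' Iio 0 ↔ ∃ t, 0 < t ∧ v = resolventMean μ a t := by
  constructor
  · rintro ⟨z, hz, h⟩
    have hz' : z < 0 := hz
    refine ⟨-(a * z), by nlinarith, ?_⟩
    rw [stieltjes_eq ha] at h
    exact (mul_left_cancel₀ ha.ne' h).symm
  · rintro ⟨t, ht, rfl⟩
    refine ⟨-(t / a), by simpa using div_pos ht ha, ?_⟩
    rw [stieltjes_eq ha]
    congr 2
    field_simp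

/-- The Stieltjes transform at z is a G(-a z), so the chosen preimage of a G(t) is z = -t/a; the
term -1/s of the R-transform supplies 1/G(t). -/
lemma mul_rTransform (h : IsSpectralLaw μ) (ha : 0 < a) {t : ℝ} (ht : 0 < t) :
    a * rTransform μ (-(a * resolventMean μ a t)) = etaParam μ a t := by
  have hmem : a * resolventMean μ a t ∈ stieltjes μ '' Iio 0 :=
    (mem_image_stieltjes ha _).2 ⟨t, ht, rfl⟩
  have h1 := Function.invFunOn_eq hmem
  have h2 : Function.invFunOn (stieltjes μ) (Iio 0) (a * resolventMean μ a t) < 0 :=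
    Function.invFunOn_mem hmem
  set z := Function.invFunOn (stieltjes μ) (Iio 0) (a * resolventMean μ a t) with hz
  rw [stieltjes_eq ha] at h1
  have h3 := (h.strictAntiOn_resolventMean ha).injOn (mem_Ioi.2 (show 0 < -(a * z) by nlinarith)) ht
    (mul_left_cancel₀ ha.ne' h1)
  have hg := (h.resolventMean_pos ha ht).ne'
  rw [rTransform, neg_neg, ← hz, etaParam, ← h3]
  rw [h3]
  field_simp
  rw [← h3]
  ring

/-- The sign of `φ - η⁻¹` along the curve `t ↦ (etaParam t, resolventMean t)` around the unique
fixed point. -/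
lemma exists_crossing (h : IsSpectralLaw μ) (hP : IsSignalLaw P) (ha : 0 < a)
    (hγ : ∀ w, 0 < w → γ w = resolventMean μ a w⁻¹) (hφ : ∀ r, 0 ≤ r → φ r = mmse P (√r))
    {ρ : ℝ} (hfp : IsUniqueFixedPoint γ φ ρ) :
    ∃ t, 0 < t ∧ 0 < ρ ∧ φ ρ = resolventMean μ a t ∧ ρ = etaParam μ a t ∧
      (∀ u, 0 < u → 0 < etaParam μ a u) ∧
      (∀ u, 0 < u → u < t → φ (etaParam μ a u) < resolventMean μ a u) ∧
      (∀ u, t < u → resolventMean μ a u < φ (etaParam μ a u)) := by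
  obtain ⟨⟨hρ, hdom, heta⟩, huniq⟩ := hfp
  rw [etaDomain_eq hγ] at hdom
  obtain ⟨t, ht, hvt⟩ := hdom
  have ht0 : 0 < t := ht
  rw [← hvt, eta_resolventMean h ha hγ ht0] at heta
  have hpos : ∀ u, 0 < u → 0 < etaParam μ a u := fun u hu =>
    lt_of_le_of_ne (h.etaParam_nonneg ha hu) fun h0 => by
      have := h.etaParam_eq_zero ha hu h0.symm (t' := t)
      linarith
  have hne : ∀ u, 0 < u → φ (etaParam μ a u) = resolventMean μ a u → u = t := by
    intro u hu he
    have h1 : IsFixedPoint γ φ (etaParam μ a u) := by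
      refine ⟨hpos u hu, ?_, ?_⟩
      · rw [he, etaDomain_eq hγ]
        exact ⟨u, hu, rfl⟩
      · rw [he, eta_resolventMean h ha hγ hu]
    have h2 := huniq _ h1
    rw [h2, ← hvt] at he
    exact ((h.strictAntiOn_resolventMean ha).injOn ht hu he).symm
  set H : ℝ → ℝ := fun u => mmse P (√(etaParam μ a u)) - resolventMean μ a u with hH
  have hHφ : ∀ u, 0 < u → H u = φ (etaParam μ a u) - resolventMean μ a u := fun u hu => by
    rw [hφ _ (hpos u hu).le]
  have hHc : ContinuousOn H (Ioi 0) :=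
    ((hP.continuous_mmse.comp Real.continuous_sqrt).comp_continuousOn
      (h.continuousOn_etaParam ha)).sub (h.continuousOn_resolventMean ha)
  have hH0 : ∀ u, 0 < u → H u = 0 → u = t := fun u hu h0 =>
    hne u hu (sub_eq_zero.1 (by rw [← hHφ u hu, h0]))
  -- The linear bound suffices: G (1 + 1/G - u) = 1 + (1 - u) G exceeds 1 as soon as u < 1.
  have hsmall : ∀ u, 0 < u → u < 1 → H u < 0 := by
    intro u hu hu1
    have h1 := hP.mmse_le_inv (√(etaParam μ a u))
    rw [Real.sq_sqrt (hpos u hu).le] at h1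
    have hg := h.resolventMean_pos ha hu
    have h2 : (1 + etaParam μ a u)⁻¹ < resolventMean μ a u := by
      rw [inv_lt_iff_one_lt_mul₀ (by linarith [hpos u hu])]
      have : resolventMean μ a u * (1 + etaParam μ a u)
          = 1 + (1 - u) * resolventMean μ a u := by
        rw [etaParam]
        field_simp
        ring
      rw [this]
      nlinarith
    exact sub_neg.2 (h1.trans_lt h2)
  -- The first coordinate stays below a m, so the MMSE keeps a positive lower bound while G tends to
  -- 0. The bound is positive because φ(ρ) = G(t) > 0 excludes a vanishing MMSE.
  have hlarge : ∃ T, ∀ u, T < u → 0 < u → 0 < H u := by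
    have hm : 0 < mmse P (√(a * ∫ x, x ∂μ)) := by
      refine lt_of_le_of_ne (IsSignalLaw.mmse_nonneg _ _) fun h0 => ?_
      have h1 := hP.mmse_eq_zero h0.symm (√ρ)
      rw [← hφ ρ hρ.le, ← hvt] at h1
      exact (h.resolventMean_pos ha ht0).ne' h1
    obtain ⟨T, hT⟩ := eventually_atTop.1 ((h.tendsto_resolventMean ha).eventually (gt_mem_nhds hm))
    refine ⟨T, fun u hu hu0 => sub_pos.2 ((hT u hu.le).trans_le ?_)⟩
    exact hP.mmse_antitone (Real.sqrt_nonneg _) (Real.sqrt_le_sqrt (h.etaParam_le ha hu0))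
  refine ⟨t, ht0, hρ, hvt.symm, heta.symm, hpos, fun u hu hut => ?_, fun u hut => ?_⟩
  · by_contra hcon
    have h1 : 0 ≤ H u := by
      rw [hHφ u hu]
      linarith [not_lt.1 hcon]
    -- A point below both u and 1, where `hsmall` applies; a zero of `H` between it and u would be a
    -- fixed point other than t.
    have hm0 : 0 < min (u / 2) (1 / 2) := by positivity
    have h2 : H (min (u / 2) (1 / 2)) < 0 :=
      hsmall _ hm0 ((min_le_right _ _).trans_lt (by norm_num))
    have hle : min (u / 2) (1 / 2) ≤ u := (min_le_left _ _).trans (by linarith)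
    obtain ⟨w, hw, hw0⟩ := intermediate_value_Icc hle
      (hHc.mono fun x hx => hm0.trans_le hx.1) ⟨h2.le, h1⟩
    have := hH0 w (hm0.trans_le hw.1) hw0
    linarith [hw.2]
  · have hu : 0 < u := ht0.trans hut
    by_contra hcon
    have h1 : H u ≤ 0 := by
      rw [hHφ u hu]
      linarith [not_lt.1 hcon]
    obtain ⟨T, hT⟩ := hlarge
    have hle : u ≤ max (T + 1) u := le_max_right _ _
    have h2 : 0 < H (max (T + 1) u) :=
      hT _ (lt_of_lt_of_le (by linarith) (le_max_left _ _)) (hu.trans_le hle)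
    obtain ⟨w, hw, hw0⟩ := intermediate_value_Icc hle
      (hHc.mono fun x hx => hu.trans_le hx.1) ⟨h1, h2.le⟩
    have := hH0 w (hu.trans_le hw.1) hw0
    linarith [hw.1]

/-- The area below both curves, split at the crossing. -/
lemma volume_areaRegion (h : IsSpectralLaw μ) (hP : IsSignalLaw P) (ha : 0 < a)
    (hγ : ∀ w, 0 < w → γ w = resolventMean μ a w⁻¹) (hφ : ∀ r, 0 ≤ r → φ r = mmse P (√r))
    {ρ t : ℝ} (ht : 0 < t) (hρ : 0 < ρ) (hρt : ρ = etaParam μ a t)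
    (hbelow : ∀ u, 0 < u → u < t → φ (etaParam μ a u) < resolventMean μ a u)
    (habove : ∀ u, t < u → resolventMean μ a u < φ (etaParam μ a u)) :
    volume (areaRegion γ φ) = ENNReal.ofReal (∫ r in (0 : ℝ)..ρ, φ r)
      + ENNReal.ofReal (∫ u in Ioc 0 (resolventMean μ a t), (eta γ u - ρ)) := by
  have hφc : ContinuousOn φ (Ici 0) :=
    (hP.continuous_mmse.comp Real.continuous_sqrt).continuousOn.congr fun r hr => hφ r hr
  have hφa : ∀ r r', 0 ≤ r → r ≤ r' → φ r' ≤ φ r := fun r r' hr hrr => by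
    rw [hφ r hr, hφ r' (hr.trans hrr)]
    exact hP.mmse_antitone (Real.sqrt_nonneg _) (Real.sqrt_le_sqrt hrr)
  have hφ0 : ∀ r, 0 ≤ r → 0 ≤ φ r := fun r hr => by
    rw [hφ r hr]; exact IsSignalLaw.mmse_nonneg _ _
  have hdom : ∀ p : ℝ × ℝ, (∀ u ∈ etaDomain γ, eta γ u ≤ p.1 → p.2 ≤ u) ↔
      ∀ t', 0 < t' → etaParam μ a t' ≤ p.1 → p.2 ≤ resolventMean μ a t' := by
    intro p
    rw [etaDomain_eq hγ]
    simp only [forall_mem_image, mem_Ioi]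
    refine forall_congr' fun t' => forall_congr' fun ht' => ?_
    rw [eta_resolventMean h ha hγ ht']
  set v := resolventMean μ a t with hvdef
  have hv0 : 0 < v := h.resolventMean_pos ha ht
  have hparam : ∀ u, 0 < u → u ≤ v → ∃ t', t ≤ t' ∧ u = resolventMean μ a t' := by
    intro u hu huv
    rcases huv.eq_or_lt with rfl | hlt
    · exact ⟨t, le_rfl, rfl⟩
    · have : u ∈ Ioo 0 v := ⟨hu, hlt⟩
      rw [hvdef, ← h.image_Ioi_resolventMean ha ht] at this
      obtain ⟨t', ht', rfl⟩ := this
      exact ⟨t', le_of_lt ht', rfl⟩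
  have hηi : IntegrableOn (eta γ) (Ioc 0 v) := by
    rw [integrableOn_Ioc_iff_integrableOn_Ioo]
    exact (h.integral_eta ha ht fun u hu => eta_resolventMean h ha hγ hu).1
  have hms : MeasurableSet {p : ℝ × ℝ | p.1 < ρ} := measurableSet_lt measurable_fst measurable_const
  -- Cut at abscissa ρ: the left part is integrated over ρ, the right part over v after exchanging
  -- the axes.
  rw [← measure_inter_add_sdiff (areaRegion γ φ) hms]
  congr 1
  · rw [intervalIntegral.integral_of_le hρ.le, integral_Ioc_eq_integral_Ioo]
    have hφi : IntegrableOn φ (Ioo 0 ρ) :=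
      ((hφc.mono Icc_subset_Ici_self).integrableOn_compact isCompact_Icc).mono_set Ioo_subset_Icc_self
    have := volume_eq_of_regionBetween (S := areaRegion γ φ ∩ {p : ℝ × ℝ | p.1 < ρ}) (f := 0)
      (g := φ) (s := Ioo 0 ρ) measurableSet_Ioo (by simp) integrableOn_zero hφi
      (fun x hx => hφ0 x hx.1.le) ?_ ?_
    · simpa using this
    · rintro p ⟨⟨h0, h1⟩, h2, h3⟩
      refine ⟨⟨h0, h2, h3.le, (hdom p).2 fun t' ht' hle => ?_⟩, h1⟩
      -- A curve point with abscissa below ρ has parameter below t, where the curve lies above φ, so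
      -- only φ constrains.
      have hlt : t' < t := by
        by_contra hcon
        have := h.monotoneOn_etaParam ha ht ht' (not_lt.1 hcon)
        linarith
      exact h3.le.trans ((hφa _ _ (h.etaParam_nonneg ha ht') hle).trans (hbelow t' ht' hlt).le)
    · rintro p ⟨⟨h0, h1, h2, -⟩, h3⟩
      exact ⟨⟨h0, h3⟩, h1.le, h2⟩
  · have hswap := (Measure.measurePreserving_swap (μ := (volume : Measure ℝ))
      (ν := (volume : Measure ℝ))).measure_preimage_equiv (f := MeasurableEquiv.prodComm)
        (areaRegion γ φ \ {p : ℝ × ℝ | p.1 < ρ})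
    rw [← Measure.volume_eq_prod] at hswap
    rw [← hswap]
    refine volume_eq_of_regionBetween (f := fun _ => ρ) (g := eta γ) measurableSet_Ioc (by simp)
      (integrableOn_const (by simp)) hηi (fun u hu => ?_) ?_ ?_
    · obtain ⟨t', htt, rfl⟩ := hparam u hu.1 hu.2
      rw [eta_resolventMean h ha hγ (ht.trans_le htt), hρt]
      exact h.monotoneOn_etaParam ha ht (ht.trans_le htt) htt
    · rintro ⟨u, r⟩ ⟨⟨hu, huv⟩, h1, h2⟩
      obtain ⟨t', htt, rfl⟩ := hparam u hu huv
      have ht' := ht.trans_le htt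
      simp only [eta_resolventMean h ha hγ ht'] at h1 h2
      have hlt : t < t' := by
        refine lt_of_le_of_ne htt ?_
        rintro rfl
        linarith
      refine ⟨⟨hρ.trans h1, hu, ?_, (hdom _).2 fun t'' ht'' hle => ?_⟩, not_lt.2 h1.le⟩
      -- Beyond the crossing φ lies above the curve, so only η constrains.
      · exact (habove t' hlt).le.trans (hφa _ _ (hρ.trans h1).le h2.le)
      · have hle' : etaParam μ a t'' ≤ r := hle
        have : t'' < t' := by
          by_contra hcon
          have := h.monotoneOn_etaParam ha ht' ht'' (not_lt.1 hcon)
          linarith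
        exact (h.strictAntiOn_resolventMean ha ht'' ht' this).le
    · rintro ⟨u, r⟩ ⟨⟨h0, hu, -, h3⟩, h4⟩
      have h3' := (hdom (r, u)).1 h3
      have hr : ρ ≤ r := not_lt.1 h4
      have hu' : 0 < u := hu
      have huv : u ≤ v := h3' t ht (by rw [← hρt]; exact hr)
      refine ⟨⟨hu', huv⟩, hr, ?_⟩
      obtain ⟨t', htt, rfl⟩ := hparam u hu' huv
      have ht' := ht.trans_le htt
      simp only [eta_resolventMean h ha hγ ht']
      -- Membership constrains r only through parameters above t', since the resolvent is strictly
      -- smaller there; continuity carries the bound down to t' itself.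
      have hl := ((h.hasDerivAt_etaParam ha ht').continuousAt.tendsto).mono_left
        (nhdsWithin_le_nhds (s := Ioi t'))
      refine ge_of_tendsto hl ?_
      filter_upwards [self_mem_nhdsWithin] with t'' hlt
      have ht'' : 0 < t'' := ht'.trans hlt
      by_contra hcon
      have h5 := h3' t'' ht'' (not_le.1 hcon).le
      exact absurd (h.strictAntiOn_resolventMean ha ht' ht'' hlt) (not_lt.2 h5)

/-- The replica capacity, the enclosed area and the log-determinant formula agree. -/
theorem capacity_eq_area (h : IsSpectralLaw μ) (hP : IsSignalLaw P) (ha : 0 < a)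
    (hγ : ∀ w, 0 < w → γ w = resolventMean μ a w⁻¹) (hφ : ∀ r, 0 ≤ r → φ r = mmse P (√r))
    {ρ v : ℝ} (hfp : IsUniqueFixedPoint γ φ ρ) (hv : v = φ ρ) :
    0 < v ∧ 0 < v⁻¹ - ρ ∧ IntervalIntegrable φ volume 0 ρ ∧
    ∃ C : ℝ, C = (∫ r in (0 : ℝ)..ρ, φ r) + Real.log v + logPotential μ a (v⁻¹ - ρ) ∧
      IsReplicaCapacity a μ P φ C ∧ IsEnclosedArea γ φ C := by
  obtain ⟨t, ht, hρ, hvt, hρt, hpos, hbelow, habove⟩ := exists_crossing h hP ha hγ hφ hfp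
  have hv' : v = resolventMean μ a t := hv.trans hvt
  have hv0 : 0 < v := hv' ▸ h.resolventMean_pos ha ht
  have htv : v⁻¹ - ρ = t := by
    rw [hρt, hv', etaParam]
    ring
  have hφc : ContinuousOn φ (Ici 0) :=
    (hP.continuous_mmse.comp Real.continuous_sqrt).continuousOn.congr fun r hr => hφ r hr
  have hφi : IntervalIntegrable φ volume 0 ρ :=
    (hφc.mono (by rw [uIcc_of_le hρ.le]; exact Icc_subset_Ici_self)).intervalIntegrable
  have hI : ∫ r in (0 : ℝ)..ρ, φ r = gaussianInfo P (√ρ) := by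
    rw [← hP.integral_mmse hρ.le]
    refine intervalIntegral.integral_congr fun r hr => ?_
    rw [uIcc_of_le hρ.le] at hr
    exact hφ r hr.1
  refine ⟨hv0, by rwa [htv], hφi, _, rfl, ?_, ?_⟩
  -- The R-transform after the substitution z = a u, which makes it coincide with η on (0, v).
  · set f : ℝ → ℝ := fun u => a * rTransform μ (-(u * a)) with hf
    have hfe : ∀ u, 0 < u → f (resolventMean μ a u) = etaParam μ a u := fun u hu => by
      rw [hf, ← mul_rTransform h ha hu, mul_comm a (resolventMean μ a u)]
    obtain ⟨hf1, hf2⟩ := h.integral_eta ha ht hfe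
    rw [← hv'] at hf1 hf2
    have hint : IntervalIntegrable f volume 0 v := by
      rw [intervalIntegrable_iff_integrableOn_Ioo_of_le hv0.le]
      exact hf1
    refine ⟨ρ, v, ⟨hρ.le, (mem_image_stieltjes ha v).2 ⟨t, ht, hv'⟩, ?_, hv⟩, ?_, ?_,
      (hP.channelInfo_eq ρ).1, ?_⟩
    · rw [hv', mul_rTransform h ha ht, ← hρt]
    · rintro ρ' v' ⟨h0, h1, h2, h3⟩
      obtain ⟨t', ht', rfl⟩ := (mem_image_stieltjes ha v').1 h1
      rw [mul_rTransform h ha ht'] at h2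
      have hfix : IsFixedPoint γ φ ρ' := by
        refine ⟨h2 ▸ hpos t' ht', ?_, ?_⟩
        · rw [← h3, etaDomain_eq hγ]
          exact ⟨t', ht', rfl⟩
        · rw [← h3, eta_resolventMean h ha hγ ht', h2]
      have := hfp.2 ρ' hfix
      exact ⟨this, by rw [h3, this, hv]⟩
    · have h1 := (hint.comp_mul_right (c := a⁻¹)).const_mul a⁻¹
      simp only [div_inv_eq_mul, zero_mul] at h1
      refine h1.congr fun z _ => ?_
      simp only [hf]
      rw [inv_mul_cancel_left₀ ha.ne', inv_mul_cancel_right₀ ha.ne']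
    · have h1 : ∫ z in (0 : ℝ)..(v * a), rTransform μ (-z) = ∫ u in (0 : ℝ)..v, f u := by
        have := intervalIntegral.integral_comp_mul_right (a := 0) (b := v)
          (fun z => rTransform μ (-z)) ha.ne'
        rw [hf, intervalIntegral.integral_const_mul, this, zero_mul, smul_eq_mul,
          mul_inv_cancel_left₀ ha.ne']
      rw [h1, intervalIntegral.integral_of_le hv0.le, integral_Ioc_eq_integral_Ioo, hf2,
        (hP.channelInfo_eq ρ).2, hI, htv]
      -- This cancels the -t v + 1 left by `integral_eta` against -ρ v.
      have : t * v = 1 - ρ * v := by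
        rw [← htv]
        field_simp
      linarith
  · have hvol := volume_areaRegion h hP ha hγ hφ ht hρ hρt hbelow habove
    obtain ⟨he1, he2⟩ := h.integral_eta ha ht (f := eta γ) fun u hu => eta_resolventMean h ha hγ hu
    have hA : 0 ≤ ∫ r in (0 : ℝ)..ρ, φ r :=
      intervalIntegral.integral_nonneg hρ.le fun r hr => by
        rw [hφ r hr.1]; exact IsSignalLaw.mmse_nonneg _ _
    have hB : ∫ u in Ioc 0 (resolventMean μ a t), (eta γ u - ρ)
        = Real.log v + logPotential μ a t := by
      rw [integral_Ioc_eq_integral_Ioo, integral_sub he1 (integrableOn_const (by simp)), he2,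
        ← hv']
      have : t * v = 1 - ρ * v := by
        rw [← htv]
        field_simp
      simp [hv0.le]
      linarith
    have hB0 : 0 ≤ ∫ u in Ioc 0 (resolventMean μ a t), (eta γ u - ρ) := by
      rw [integral_Ioc_eq_integral_Ioo, ← h.image_Ioi_resolventMean ha ht]
      refine setIntegral_nonneg (by
        rw [h.image_Ioi_resolventMean ha ht]; exact measurableSet_Ioo) ?_
      rintro _ ⟨u, hu, rfl⟩
      have hu0 : 0 < u := ht.trans hu
      rw [eta_resolventMean h ha hγ hu0, hρt]
      exact sub_nonneg.2 (h.monotoneOn_etaParam ha ht hu0 (le_of_lt hu))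
    rw [← ENNReal.ofReal_add hA hB0, hB] at hvol
    refine ⟨by rw [hvol]; exact ENNReal.ofReal_ne_top, ?_⟩
    rw [hvol, ENNReal.toReal_ofReal (by rw [← hB]; exact add_nonneg hA hB0), htv]
    ring

end Transfer

/-! ### Gram matrices -/

section Gram

variable {M N : ℕ} (A : Matrix (Fin M) (Fin N) ℂ)

lemma integrable_gramLaw (f : ℝ → ℝ) (hN : 0 < N) :
    Integrable f (gramLaw A) := by
  -- Positivity of `N` matters: for `N` = 0 the weight would be ∞.
  refine Integrable.smul_measure ?_ (by simp; omega)
  exact integrable_finsetSum_measure.2 fun i _ => integrable_dirac (by simp)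

lemma integral_gramLaw (f : ℝ → ℝ) :
    ∫ x, f x ∂(gramLaw A)
      = (N : ℝ)⁻¹ * ∑ i, f ((isHermitian_conjTranspose_mul_self A).eigenvalues i) := by
  rw [gramLaw, integral_smul_measure,
    integral_finsetSum_measure fun i _ => integrable_dirac (by simp)]
  simp

open scoped ComplexOrder in
lemma gram_eigenvalues_nonneg (i : Fin N) :
    0 ≤ (isHermitian_conjTranspose_mul_self A).eigenvalues i :=
  (posSemidef_conjTranspose_mul_self A).eigenvalues_nonneg i

lemma gramLaw_nonneg : ∀ᵐ x ∂(gramLaw A), 0 ≤ x := by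
  refine Measure.ae_smul_measure ?_ _
  rw [ae_finsetSum_measure_iff]
  intro i _
  exact (ae_dirac_iff measurableSet_Ici).2 (gram_eigenvalues_nonneg A i)

lemma isSpectralLaw_gramLaw (hN : 0 < N) : IsSpectralLaw (gramLaw A) where
  prob := by
    refine ⟨?_⟩
    have : (N : ℝ≥0∞) ≠ 0 := by simp; omega
    simp [gramLaw, ENNReal.inv_mul_cancel this]
  nonneg := gramLaw_nonneg A
  integrable := integrable_gramLaw A _ hN

/-- One diagonalization serves both the trace of the inverse and the determinant. -/
lemma smul_gram_add_eq (a c : ℝ) :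
    (a : ℂ) • (Aᴴ * A) + (c : ℂ) • (1 : Matrix (Fin N) (Fin N) ℂ)
      = (Unitary.conjStarAlgAut ℂ (Matrix (Fin N) (Fin N) ℂ))
        (isHermitian_conjTranspose_mul_self A).eigenvectorUnitary
        (Matrix.diagonal fun i =>
          ((a * (isHermitian_conjTranspose_mul_self A).eigenvalues i + c : ℝ) : ℂ)) := by
  have h1 : (Matrix.diagonal fun i =>
      ((a * (isHermitian_conjTranspose_mul_self A).eigenvalues i + c : ℝ) : ℂ))
      = (a : ℂ) • Matrix.diagonal (RCLike.ofReal ∘ (isHermitian_conjTranspose_mul_self A).eigenvalues)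
        + (c : ℂ) • (1 : Matrix (Fin N) (Fin N) ℂ) := by
    ext i j
    by_cases hij : i = j
    · subst hij
      simp
    · simp [hij]
  rw [h1, map_add, map_smul, map_smul, map_one, ← IsHermitian.spectral_theorem]

lemma gammaHat_eq {a : ℝ} (ha : 0 < a) {w : ℝ} (hw : 0 < w) :
    gammaHat a A w = resolventMean (gramLaw A) a w⁻¹ := by
  have hpos : ∀ i, 0 < a * (isHermitian_conjTranspose_mul_self A).eigenvalues i + w⁻¹ := fun i => by
    have := gram_eigenvalues_nonneg A i
    positivity
  rw [gammaHat, resolventMean, integral_gramLaw A,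
    smul_gram_add_eq]
  set U := (isHermitian_conjTranspose_mul_self A).eigenvectorUnitary
  have h1 : (Unitary.conjStarAlgAut ℂ (Matrix (Fin N) (Fin N) ℂ) U (Matrix.diagonal fun i =>
      ((a * (isHermitian_conjTranspose_mul_self A).eigenvalues i + w⁻¹ : ℝ) : ℂ)))⁻¹
      = Unitary.conjStarAlgAut ℂ (Matrix (Fin N) (Fin N) ℂ) U (Matrix.diagonal fun i =>
      (((a * (isHermitian_conjTranspose_mul_self A).eigenvalues i + w⁻¹)⁻¹ : ℝ) : ℂ)) := by
    refine inv_eq_right_inv ?_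
    rw [← map_mul, diagonal_mul_diagonal]
    have : (fun i => ((a * (isHermitian_conjTranspose_mul_self A).eigenvalues i + w⁻¹ : ℝ) : ℂ)
        * (((a * (isHermitian_conjTranspose_mul_self A).eigenvalues i + w⁻¹)⁻¹ : ℝ) : ℂ))
        = fun _ => 1 := by
      ext i
      rw [← Complex.ofReal_mul, mul_inv_cancel₀ (hpos i).ne', Complex.ofReal_one]
    rw [this, diagonal_one, map_one]
  rw [h1, Unitary.conjStarAlgAut_apply, trace_mul_cycle, Unitary.coe_star_mul_self, one_mul,
    trace_diagonal, ← Complex.ofReal_sum, Complex.ofReal_re]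

lemma logDet_eq {a : ℝ} (ha : 0 < a) {c : ℝ} (hc : 0 < c) :
    logDet a A c = logPotential (gramLaw A) a c := by
  have hpos : ∀ i, 0 < a * (isHermitian_conjTranspose_mul_self A).eigenvalues i + c := fun i => by
    have := gram_eigenvalues_nonneg A i
    positivity
  rw [logDet, logPotential, integral_gramLaw A,
    add_comm, smul_gram_add_eq, Unitary.conjStarAlgAut_apply, det_mul_right_comm, Unitary.mul_star_self_of_mem (SetLike.coe_mem _),
    one_mul, det_diagonal, ← Complex.ofReal_prod, Complex.ofReal_re,
    Real.log_prod fun i _ => (hpos i).ne']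

end Gram

/-! ### The large-system limit -/

section Limit

variable {ν : ℕ → Measure ℝ} {μ : Measure ℝ} {a : ℝ}

lemma tendsto_resolventMean_of_weak (h : IsSpectralLaw μ) (hν : ∀ k, ∀ᵐ x ∂(ν k), 0 ≤ x)
    (hlim : ∀ f : BoundedContinuousFunction ℝ ℝ,
      Tendsto (fun k => ∫ x, f x ∂(ν k)) atTop (𝓝 (∫ x, f x ∂μ)))
    (ha : 0 < a) {t : ℝ} (ht : 0 < t) :
    Tendsto (fun k => resolventMean (ν k) a t) atTop (𝓝 (resolventMean μ a t)) := by
  have hpos : ∀ x : ℝ, 0 < a * max x 0 + t := fun x => by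
    have := le_max_right x 0
    positivity
  -- Replacing x by max x 0 makes the test function bounded and continuous on all of ℝ without
  -- changing integrals on [0, ∞).
  set f : BoundedContinuousFunction ℝ ℝ := BoundedContinuousFunction.ofNormedAddCommGroup
    (fun x => (a * max x 0 + t)⁻¹)
    (Continuous.inv₀ (by fun_prop) fun x => (hpos x).ne') t⁻¹ (fun x => by
      rw [Real.norm_of_nonneg (inv_nonneg.2 (hpos x).le)]
      have := le_max_right x 0
      exact inv_anti₀ ht (le_add_of_nonneg_left (by positivity))) with hf
  have he : ∀ σ : Measure ℝ, (∀ᵐ x ∂σ, 0 ≤ x) → ∫ x, f x ∂σ = resolventMean σ a t := by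
    intro σ hσ
    refine integral_congr_ae ?_
    filter_upwards [hσ] with x hx
    simp [hf, max_eq_left hx]
  have := hlim f
  rw [he μ h.nonneg] at this
  refine this.congr fun k => he _ (hν k)

/-- Truncation at level `K`, as a bounded continuous function. -/
def truncation (K : ℝ) : BoundedContinuousFunction ℝ ℝ :=
  BoundedContinuousFunction.ofNormedAddCommGroup (fun x => min (max x 0) (max K 0))
    (by fun_prop) (max K 0) (fun x => by
      rw [Real.norm_of_nonneg (le_min (le_max_right _ _) (le_max_right _ _))]
      exact min_le_right _ _)

lemma truncation_apply (K x : ℝ) : truncation K x = min (max x 0) (max K 0) := rfl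

lemma truncation_nonneg (K x : ℝ) : 0 ≤ truncation K x :=
  le_min (le_max_right _ _) (le_max_right _ _)

lemma truncation_le (K : ℝ) {x : ℝ} (hx : 0 ≤ x) : truncation K x ≤ x := by
  rw [truncation_apply, max_eq_left hx]
  exact min_le_left _ _

/-- The logarithm of an affine function of a truncation. -/
def logTruncation (a t K : ℝ) (ha : 0 < a) (ht : 0 < t) : BoundedContinuousFunction ℝ ℝ :=
  BoundedContinuousFunction.ofNormedAddCommGroup (fun x => Real.log (a * truncation K x + t))
    (Continuous.log (by fun_prop) fun x => by
      have := truncation_nonneg K x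
      positivity)
    (max |Real.log t| |Real.log (a * max K 0 + t)|) (fun x => by
      have h0 := truncation_nonneg K x
      have h1 : truncation K x ≤ max K 0 := min_le_right _ _
      refine abs_le_max_abs_abs (Real.log_le_log ht (le_add_of_nonneg_left (by positivity)))
        (Real.log_le_log (by positivity) ?_)
      gcongr)

/-- On [0, ∞) the map x ↦ log(a x + t) has slope at most a/t, so its truncation error is controlled
by that of the mean. -/
lemma abs_logPotential_sub_le (h : IsSpectralLaw μ) (ha : 0 < a) {t : ℝ} (ht : 0 < t) (K : ℝ) :
    |logPotential μ a t - ∫ x, logTruncation a t K ha ht x ∂μ|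
      ≤ a / t * ((∫ x, x ∂μ) - ∫ x, truncation K x ∂μ) := by
  have := h.prob
  have i1 : Integrable (logTruncation a t K ha ht) μ := BoundedContinuousFunction.integrable _ _
  have i2 : Integrable (truncation K) μ := BoundedContinuousFunction.integrable _ _
  rw [logPotential, ← integral_sub (h.integrable_log ha ht) i1, ← integral_sub h.integrable i2,
    ← integral_const_mul]
  refine (abs_integral_le_integral_abs).trans (integral_mono_ae
    ((h.integrable_log ha ht).sub i1).abs ((h.integrable.sub i2).const_mul _) ?_)
  filter_upwards [h.nonneg] with x hx
  have h0 := truncation_nonneg K x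
  have h1 := truncation_le K hx
  have e : logTruncation a t K ha ht x = Real.log (a * truncation K x + t) := rfl
  have p1 : 0 < a * truncation K x + t := by positivity
  have p2 : a * truncation K x + t ≤ a * x + t := by gcongr
  simp only [e]
  rw [abs_of_nonneg (sub_nonneg.2 (Real.log_le_log p1 p2)), ← Real.log_div (by positivity) p1.ne']
  refine (Real.log_le_sub_one_of_pos (by positivity)).trans ?_
  rw [div_sub_one p1.ne', div_mul_eq_mul_div]
  have : a * x + t - (a * truncation K x + t) = a * (x - truncation K x) := by ring
  rw [this]
  have hxt : 0 ≤ x - truncation K x := sub_nonneg.2 h1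
  gcongr
  linarith [mul_nonneg ha.le h0]

lemma tendsto_integral_truncation (h : IsSpectralLaw μ) :
    Tendsto (fun K : ℝ => ∫ x, truncation K x ∂μ) atTop (𝓝 (∫ x, x ∂μ)) := by
  refine tendsto_integral_filter_of_dominated_convergence (fun x => x)
    (Eventually.of_forall fun K => (truncation K).continuous.aestronglyMeasurable)
    (Eventually.of_forall fun K => ?_) h.integrable ?_
  · filter_upwards [h.nonneg] with x hx
    rw [Real.norm_of_nonneg (truncation_nonneg K x)]
    exact truncation_le K hx
  · filter_upwards [h.nonneg] with x hx
    refine tendsto_const_nhds.congr' ?_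
    filter_upwards [eventually_ge_atTop x] with K hK
    rw [truncation_apply, max_eq_left hx, max_eq_left (hx.trans hK), min_eq_left hK]

/-- The logarithm is unbounded, so weak convergence alone is not enough. Convergence of the means
makes the truncation error small for all large k. -/
lemma tendsto_logPotential_of_weak (h : IsSpectralLaw μ)
    (hν : ∀ᶠ k in atTop, IsSpectralLaw (ν k))
    (hlim : ∀ f : BoundedContinuousFunction ℝ ℝ,
      Tendsto (fun k => ∫ x, f x ∂(ν k)) atTop (𝓝 (∫ x, f x ∂μ)))
    (hmean : Tendsto (fun k => ∫ x, x ∂(ν k)) atTop (𝓝 (∫ x, x ∂μ)))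
    (ha : 0 < a) {t : ℝ} (ht : 0 < t) :
    Tendsto (fun k => logPotential (ν k) a t) atTop (𝓝 (logPotential μ a t)) := by
  rw [Metric.tendsto_nhds]
  intro ε hε
  have hK : Tendsto (fun K : ℝ => a / t * ((∫ x, x ∂μ) - ∫ x, truncation K x ∂μ)) atTop (𝓝 0) := by
    simpa using ((tendsto_integral_truncation h).const_sub (∫ x, x ∂μ)).const_mul (a / t)
  -- Three errors below ε/4 each: truncation under ν k, truncation under μ, and convergence of the
  -- truncated integrals.
  obtain ⟨K, hKε⟩ := (hK.eventually (gt_mem_nhds (show 0 < ε / 4 by positivity))).exists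
  have hq : Tendsto (fun k => a / t * ((∫ x, x ∂(ν k)) - ∫ x, truncation K x ∂(ν k))) atTop
      (𝓝 (a / t * ((∫ x, x ∂μ) - ∫ x, truncation K x ∂μ))) :=
    (hmean.sub (hlim _)).const_mul _
  have hf := Metric.tendsto_nhds.1 (hlim (logTruncation a t K ha ht)) (ε / 4) (by positivity)
  filter_upwards [hν, hq.eventually (gt_mem_nhds hKε), hf] with k h1 h2 h3
  have e1 := abs_logPotential_sub_le h1 ha ht K
  have e2 := abs_logPotential_sub_le h ha ht K
  rw [Real.dist_eq] at h3 ⊢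
  rw [abs_le] at e1 e2
  rw [abs_lt] at h3 ⊢
  constructor <;> linarith [e1.1, e1.2, e2.1, e2.2, h3.1, h3.2]

/-- The test function min(max(-x, 0), 1) vanishes on [0, ∞) and is positive on the negative
half-line. -/
lemma nonneg_of_weak [IsProbabilityMeasure μ] (hν : ∀ k, ∀ᵐ x ∂(ν k), 0 ≤ x)
    (hlim : ∀ f : BoundedContinuousFunction ℝ ℝ,
      Tendsto (fun k => ∫ x, f x ∂(ν k)) atTop (𝓝 (∫ x, f x ∂μ))) :
    ∀ᵐ x ∂μ, 0 ≤ x := by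
  set f : BoundedContinuousFunction ℝ ℝ := (truncation 1).compContinuous ⟨fun x => -x, by fun_prop⟩
    with hf
  have hfx : ∀ x, f x = truncation 1 (-x) := fun x => rfl
  have h0 : ∀ k, ∫ x, f x ∂(ν k) = 0 := fun k => by
    refine integral_eq_zero_of_ae ?_
    filter_upwards [hν k] with x hx
    rw [hfx, truncation_apply]
    simp [hx]
  have h1 := hlim f
  simp_rw [h0] at h1
  have h2 := tendsto_nhds_unique h1 tendsto_const_nhds
  rw [integral_eq_zero_iff_of_nonneg (f := f) (fun x => truncation_nonneg 1 (-x))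
    (BoundedContinuousFunction.integrable _ _)] at h2
  filter_upwards [h2] with x hx
  by_contra hneg
  have h3 : 0 < truncation 1 (-x) := by
    rw [truncation_apply]
    exact lt_min (lt_max_of_lt_left (by linarith)) (by norm_num)
  exact h3.ne' hx

end Limit

end LUIS

end

/-- The replica constrained capacity equals the area enclosed by `η⁻¹` and `φ̂`, and both equal
`∫₀^{ρ*} φ̂ + log v* + (1/N) log det ((1/v* - ρ*) I + snr Aᴴ A)`. The first half is the identity for
every fixed matrix `A`, with the transfer functions and the R-transform of `A`; the second half is
the large-system limit of unitarily invariant systems, with the limiting transfer functions and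
spectral law. -/
theorem theorem1 (snr : ℝ) (hsnr : 0 < snr) (P : Measure ℂ) (hP : IsProbabilityMeasure P)
    (hpower : ∫ x, ‖x‖ ^ 2 ∂P = 1) :
    (∀ (M N : ℕ), 0 < N → ∀ (A : Matrix (Fin M) (Fin N) ℂ) (ρ v : ℝ),
      LUIS.IsUniqueFixedPoint (LUIS.gammaHat snr A) (LUIS.phiHat P N) ρ →
      v = LUIS.phiHat P N ρ →
      0 < v ∧ 0 < v⁻¹ - ρ ∧
      IntervalIntegrable (LUIS.phiHat P N) volume 0 ρ ∧
      ∃ C : ℝ,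
        C = (∫ r in (0 : ℝ)..ρ, LUIS.phiHat P N r) + Real.log v + LUIS.logDet snr A (v⁻¹ - ρ) ∧
        LUIS.IsReplicaCapacity snr (LUIS.gramLaw A) P (LUIS.phiHat P N) C ∧
        LUIS.IsEnclosedArea (LUIS.gammaHat snr A) (LUIS.phiHat P N) C) ∧
    (∀ (Ω : Type*) [MeasurableSpace Ω] (Q : Measure Ω) [IsProbabilityMeasure Q]
      (M N : ℕ → ℕ) (A : (k : ℕ) → Ω → Matrix (Fin (M k)) (Fin (N k)) ℂ) (μ : Measure ℝ),
      LUIS.IsLUIS Q M N A μ →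
      ∀ (γ φ : ℝ → ℝ),
      (∀ w, 0 < w → ∀ᵐ ω ∂Q,
        Tendsto (fun k => LUIS.gammaHat snr (A k ω) w) atTop (𝓝 (γ w))) →
      (∀ r, 0 ≤ r → Tendsto (fun k => LUIS.phiHat P (N k) r) atTop (𝓝 (φ r))) →
      ∀ (ρ v : ℝ), LUIS.IsUniqueFixedPoint γ φ ρ → v = φ ρ →
      0 < v ∧ 0 < v⁻¹ - ρ ∧ IntervalIntegrable φ volume 0 ρ ∧
      ∃ C L : ℝ,
        (∀ᵐ ω ∂Q, Tendsto (fun k => LUIS.logDet snr (A k ω) (v⁻¹ - ρ)) atTop (𝓝 L)) ∧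
        C = (∫ r in (0 : ℝ)..ρ, φ r) + Real.log v + L ∧
        LUIS.IsReplicaCapacity snr μ P φ C ∧
        LUIS.IsEnclosedArea γ φ C) := by
  have hP' : LUIS.IsSignalLaw P := ⟨hP, hpower⟩
  refine ⟨fun M N hN A ρ v hfp hv => ?_, fun Ω _ Q _ M N A μ hA γ φ hγ hφ ρ v hfp hv => ?_⟩
  · obtain ⟨h1, h2, h3, C, h4, h5⟩ := LUIS.capacity_eq_area (LUIS.isSpectralLaw_gramLaw A hN) hP'
      hsnr (fun w hw => LUIS.gammaHat_eq A hsnr hw) (fun r _ => hP'.phiHat_eq hN r) hfp hv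
    exact ⟨h1, h2, h3, C, by rw [h4, LUIS.logDet_eq A hsnr h2], h5⟩
  · have := hA.prob
    have hNpos : ∀ᶠ k in atTop, 0 < N k := hA.cols.eventually_gt_atTop 0
    obtain ⟨ω₀, hω₀⟩ := hA.tendsto_law.exists
    have hμ : LUIS.IsSpectralLaw μ :=
      ⟨hA.prob, LUIS.nonneg_of_weak (fun k => LUIS.gramLaw_nonneg (A k ω₀)) hω₀, hA.integrable⟩
    have hγ' : ∀ w, 0 < w → γ w = LUIS.resolventMean μ snr w⁻¹ := by
      intro w hw
      -- The exceptional set may depend on w; one good outcome for each w identifies the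
      -- deterministic limit.
      obtain ⟨ω, hω1, hω2⟩ := ((hγ w hw).and hA.tendsto_law).exists
      refine tendsto_nhds_unique hω1 ((LUIS.tendsto_resolventMean_of_weak hμ
        (fun k => LUIS.gramLaw_nonneg (A k ω)) hω2 hsnr (inv_pos.2 hw)).congr fun k => ?_)
      exact (LUIS.gammaHat_eq (A k ω) hsnr hw).symm
    have hφ' : ∀ r, 0 ≤ r → φ r = LUIS.mmse P (√r) := by
      intro r hr
      refine tendsto_nhds_unique (hφ r hr) (tendsto_const_nhds.congr' ?_)
      filter_upwards [hNpos] with k hk using (hP'.phiHat_eq hk r).symm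
    obtain ⟨h1, h2, h3, C, h4, h5⟩ := LUIS.capacity_eq_area hμ hP' hsnr hγ' hφ' hfp hv
    refine ⟨h1, h2, h3, C, LUIS.logPotential μ snr (v⁻¹ - ρ), ?_, h4, h5⟩
    filter_upwards [hA.tendsto_law, hA.tendsto_mean] with ω hω1 hω2
    refine (LUIS.tendsto_logPotential_of_weak hμ
      (hNpos.mono fun k hk => LUIS.isSpectralLaw_gramLaw (A k ω) hk) hω1 hω2 hsnr h2).congr
      fun k => ?_
    exact (LUIS.logDet_eq (A k ω) hsnr h2).symm
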